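/- Definitions. A system $\dot x=f(x)$ on $\mathbb{C}^n$ is called analytically integrable (in the Bogoyavlenskij sense) near a point $p$ if for some integer $1\le m\le n$ there are, on a neighbourhood of $p$, analytic vector fields $f_1=f,f_2,\dots,f_m$ and analytic functions $F_1,\dots,F_{n-m}$ such that: (i) $f_1,\dots,f_m$ are linearly independent almost everywhere and commute pairwise, $\mathrm{D}f_k\,f_j-\mathrm{D}f_j\,f_k\equiv0$; (ii) $\mathrm{D}F_1,\dots,\mathrm{D}F_{n-m}$ are linearly independent almost everywhere, and $\mathrm{D}F_k\cdot f_j\equiv 0$ for all $j,k$. Setting. Let $\dot x=f(x)$, $x\in\mathbb{R}^4$, be real-analytic near the origin with $f(0)=0$, and suppose that $\mathrm{D}f(0)$ has the eigenvalues $\pm i\omega_1,\pm i\omega_2$ with $\omega_1,\omega_2>0$ and $\omega_1/\omega_2\notin\mathbb{Q}$. By a formal power series change of coordinates (fixing the origin, with invertible linear part) the system is transformed to a Poincaré–Dulac normal form $$\begin{aligned} \dot x_1&=-\omega_1x_2+h_1x_1-h_2x_2, & \dot x_2&=\omega_1x_1+h_2x_1+h_1x_2,\\ \dot x_3&=-\omega_2x_4+h_3x_3-h_4x_4,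 & \dot x_4&=\omega_2x_3+h_4x_3+h_3x_4, \end{aligned}$$ where $h_j=h_j(x_1^2+x_2^2,\,x_3^2+x_4^2)$ and $h_j(y_1,y_2)$, $j=1,\dots,4$, are formal power series with real coefficients and $h_j(0,0)=0$. Fix any such normal form and let $\alpha_1,\dots,\alpha_4\in\mathbb{R}$ be the coefficients of the linear terms of $h_1$ and $h_3$: $$h_1(y_1,y_2)=\alpha_1y_1+\alpha_2y_2+\cdots,\qquad h_3(y_1,y_2)=\alpha_3y_1+\alpha_4y_2+\cdots .$$ Proposition. Assume that $(\alpha_1,\alpha_2,\alpha_3,\alpha_4)\neq(0,0,0,0)$. If the complexification of $\dot x=f(x)$ (the system on a neighbourhood of $0$ in $\mathbb{C}^4$ given by the holomorphic extension of $f$) is analytically integrable near the origin, then so is the truncated planar system $$\dot r_1=(\alpha_1r_1^2+\alpha_2r_2^2)\,r_1,\qquad \dot r_2=(\alpha_3r_1^2+\alpha_4r_2^2)\,r_2,\qquad (r_1,r_2)\in\mathbb{C}^2,$$ near $(r_1,r_2)=(0,0)$. -/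

import Mathlib

open MeasureTheory Filter Topology

noncomputable section

namespace DoubleHopf

/-- Analytic integrability in the Bogoyavlenskij sense near the point `p` of the complex system
`ẋ = f x` on `ℂⁿ`: for some `m + k = n` with `m ≥ 1`, on some open neighbourhood `U` of `p` there
are analytic vector fields `V 0 = f, V 1, …, V (m-1)` and analytic functions `F 0, …, F (k-1)` such
that the vector fields commute pairwise and are linearly independent almost everywhere, the
derivatives of the functions are linearly independent almost everywhere, and every function is a
first integral of every vector field. -/
def AnalyticallyIntegrableNear {n : ℕ} (f : (Fin n → ℂ) → (Fin n → ℂ)) (p : Fin n → ℂ) : Prop :=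
  ∃ (m k : ℕ) (hm : 0 < m), m + k = n ∧
  ∃ (U : Set (Fin n → ℂ)) (V : Fin m → (Fin n → ℂ) → (Fin n → ℂ)) (F : Fin k → (Fin n → ℂ) → ℂ),
    IsOpen U ∧ p ∈ U ∧
    Set.EqOn (V ⟨0, hm⟩) f U ∧
    (∀ j, AnalyticOnNhd ℂ (V j) U) ∧
    (∀ l, AnalyticOnNhd ℂ (F l) U) ∧
    (∀ᵐ x ∂(volume.restrict U), LinearIndependent ℂ (fun j => V j x)) ∧
    (∀ i j, ∀ x ∈ U, VectorField.lieBracket ℂ (V i) (V j) x = 0) ∧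
    (∀ᵐ x ∂(volume.restrict U), LinearIndependent ℂ (fun l => fderiv ℂ (F l) x)) ∧
    (∀ l j, ∀ x ∈ U, fderiv ℂ (F l) x (V j x) = 0)

/-- `g` is (a representative near the origin of) the complexification of the real vector field `f`:
it is holomorphic near `0 ∈ ℂⁿ` and agrees with `f` at the real points near `0`. The germ of `g`
at `0` is determined by `f`. -/
def IsComplexification {n : ℕ} (f : (Fin n → ℝ) → (Fin n → ℝ)) (g : (Fin n → ℂ) → (Fin n → ℂ)) :
    Prop :=
  AnalyticAt ℂ g 0 ∧ ∀ᶠ x in 𝓝 (0 : Fin n → ℝ), g (fun i => (x i : ℂ)) = fun i => (f x i : ℂ)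

/-- The Jacobian matrix `(∂ f_i / ∂ x_j)(0)`. -/
def jacobianAtZero {n : ℕ} (f : (Fin n → ℝ) → (Fin n → ℝ)) : Matrix (Fin n) (Fin n) ℝ :=
  Matrix.of fun i j => fderiv ℝ f 0 (Pi.single j 1) i

/-- A four-dimensional real-analytic system `ẋ = f x` with an equilibrium at the origin whose
Jacobian matrix there has two incommensurate pairs `± i ω₁`, `± i ω₂` of purely imaginary
eigenvalues. -/
structure IsDoubleHopf (f : (Fin 4 → ℝ) → (Fin 4 → ℝ)) (ω₁ ω₂ : ℝ) : Prop where
  analytic : AnalyticAt ℝ f 0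
  equilibrium : f 0 = 0
  pos₁ : 0 < ω₁
  pos₂ : 0 < ω₂
  irrational : Irrational (ω₁ / ω₂)
  eigenvalues : spectrum ℂ ((jacobianAtZero f).map Complex.ofReal) =
    {Complex.I * ω₁, -(Complex.I * ω₁), Complex.I * ω₂, -(Complex.I * ω₂)}

/-- The partial derivative `∂ F / ∂ x_i`. -/
def partialDeriv {n : ℕ} (i : Fin n) (F : (Fin n → ℝ) → ℝ) : (Fin n → ℝ) → ℝ :=
  fun x => fderiv ℝ F x (Pi.single i 1)

/-- The iterated partial derivative `∂_0^{d_0} ∂_1^{d_1} ⋯ ∂_{n-1}^{d_{n-1}} F`. -/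
def mixedPartial {n : ℕ} (d : Fin n →₀ ℕ) (F : (Fin n → ℝ) → ℝ) : (Fin n → ℝ) → ℝ :=
  (List.finRange n).foldr (fun i G => (partialDeriv i)^[d i] G) F

/-- The Taylor series of `F` at the origin, as a formal power series in `n` variables. -/
def taylorSeries {n : ℕ} (F : (Fin n → ℝ) → ℝ) : MvPowerSeries (Fin n) ℝ :=
  fun d => mixedPartial d F 0 / ∏ i, ((d i).factorial : ℝ)

/-- The system `ẋ = f x` is transformed to the formal system `ẏ = g y` by a formal power series
change of coordinates `x = Φ y` with `Φ 0 = 0` and invertible linear part, that is,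
`DΦ(y) g(y) = f (Φ y)` as formal power series. -/
def IsFormallyTransformedTo {n : ℕ} (f : (Fin n → ℝ) → (Fin n → ℝ))
    (g : Fin n → MvPowerSeries (Fin n) ℝ) : Prop :=
  ∃ Φ : Fin n → MvPowerSeries (Fin n) ℝ,
    (∀ i, MvPowerSeries.constantCoeff (Φ i) = 0) ∧
    IsUnit (Matrix.of fun i j => MvPowerSeries.coeff (Finsupp.single j 1) (Φ i)).det ∧
    ∀ i, ∑ j, MvPowerSeries.pderiv ℝ j (Φ i) * g j =
      MvPowerSeries.subst Φ (taylorSeries fun x => f x i)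

/-- For a formal power series `h (y₁, y₂)`, the formal power series
`h (x₁² + x₂², x₃² + x₄²)`. -/
def inSquaredRadii (h : MvPowerSeries (Fin 2) ℝ) : MvPowerSeries (Fin 4) ℝ :=
  MvPowerSeries.subst
    ![MvPowerSeries.X 0 ^ 2 + MvPowerSeries.X 1 ^ 2,
      MvPowerSeries.X 2 ^ 2 + MvPowerSeries.X 3 ^ 2] h

open MvPowerSeries in
/-- The (formal) Poincaré–Dulac normal form
`ẋ₁ = -ω₁ x₂ + h₁ x₁ - h₂ x₂`, `ẋ₂ = ω₁ x₁ + h₂ x₁ + h₁ x₂`,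
`ẋ₃ = -ω₂ x₄ + h₃ x₃ - h₄ x₄`, `ẋ₄ = ω₂ x₃ + h₄ x₃ + h₃ x₄`,
where each `h_j` is evaluated at `(x₁² + x₂², x₃² + x₄²)`. -/
def normalForm (ω₁ ω₂ : ℝ) (h₁ h₂ h₃ h₄ : MvPowerSeries (Fin 2) ℝ) :
    Fin 4 → MvPowerSeries (Fin 4) ℝ :=
  ![-(C ω₁ * X 1) + inSquaredRadii h₁ * X 0 - inSquaredRadii h₂ * X 1,
    C ω₁ * X 0 + inSquaredRadii h₂ * X 0 + inSquaredRadii h₁ * X 1,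
    -(C ω₂ * X 3) + inSquaredRadii h₃ * X 2 - inSquaredRadii h₄ * X 3,
    C ω₂ * X 2 + inSquaredRadii h₄ * X 2 + inSquaredRadii h₃ * X 3]

/-- The planar vector field
`ṙ₁ = (α₁ r₁² + α₂ r₂²) r₁`, `ṙ₂ = (α₃ r₁² + α₄ r₂²) r₂`, with `r = (r₁, r₂) ∈ ℂ²`. -/
def truncatedPlanar (α₁ α₂ α₃ α₄ : ℝ) : (Fin 2 → ℂ) → (Fin 2 → ℂ) := fun r =>
  ![((α₁ : ℂ) * r 0 ^ 2 + (α₂ : ℂ) * r 1 ^ 2) * r 0,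
    ((α₃ : ℂ) * r 0 ^ 2 + (α₄ : ℂ) * r 1 ^ 2) * r 1]

end DoubleHopf

end

/-!
A first integral or a commuting vector field of the analytic system has a Taylor series at the
origin, and the formal normal form lets these series be read in the coordinates `z = x₁ + i x₂`,
`w = x₁ - i x₂` (and likewise for `x₃, x₄`), in which the normal form `X` is diagonal with
coefficients depending on `y₁ = z₁ w₁` and `y₂ = z₂ w₂` only. Derivatives along `X` preserve the
weight of a monomial under the torus action of the linear part. As `ω₁ / ω₂` is irrational, only
monomials in `y₁, y₂` have weight zero, and an unbalanced monomial of least degree is multiplied by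
a nonzero eigenvalue, so that formal solutions of suitable linear systems along `X` are power series
in `y₁, y₂` (`exists_eq_inRadii_of_lieDeriv`). This applies to first integrals of `X`, and to the
derivatives of `y₁, y₂` along a vector field that commutes with `X`. In this way all objects descend
to the formal planar system `r₁' = h₁ r₁`, `r₂' = h₃ r₂` with `y_i = r_i ^ 2`.

If there is at least one analytic first integral, it gives a nonconstant formal first integral of
the planar system, and its lowest-order part is a polynomial first integral of the truncated system.
If there is none, there are four independent commuting fields, and one of them descends to a formal
planar field that commutes with the planar system and is generically independent of it
(`exists_independent_planar`). Its lowest-order part `(p r₁, q r₂)` commutes with the truncated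
system `(l₁ r₁, l₂ r₂)`. If it is independent of it, this proves integrability. Otherwise, either
`(p, q) = φ (l₁, l₂)` for a polynomial `φ`, which is then a first integral, or `l₁, l₂` are
proportional and the truncated system visibly has a first integral or a commuting field
(`integrable_or_eq_smul`). If `φ` is constant, a multiple of the planar system is subtracted from
the commuting field. This removes the degree-one part of its coefficients, so that a constant `φ`
cannot occur again (`integrable_of_formal_commute`).
-/

/-! ### Formal vector fields and substitution of power series -/

namespace MvPowerSeries

section Chain

variable {R σ τ : Type*} [CommRing R] {a : σ → MvPowerSeries τ R}

lemma coeff_subst_eq_zero_of_degree_lt [Finite σ] (ha : ∀ i, constantCoeff (a i) = 0) {n : ℕ}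
    {f : MvPowerSeries σ R} (hf : ∀ d : σ →₀ ℕ, d.degree < n → coeff d f = 0)
    {e : τ →₀ ℕ} (he : e.degree < n) : coeff e (subst a f) = 0 := by
  refine coeff_of_lt_order ?_
  have h1 : (n : ℕ∞) ≤ f.order := nat_le_order hf
  have h2 : (1 : ℕ∞) ≤ ⨅ i, (a i).order :=
    le_iInf fun i => one_le_order_iff_constCoeff_eq_zero.2 (ha i)
  have h3 := le_order_subst (hasSubst_of_constantCoeff_zero ha) f
  calc ((e.degree : ℕ) : ℕ∞) < n := by exact_mod_cast he
    _ ≤ f.order := h1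
    _ = 1 * f.order := (one_mul _).symm
    _ ≤ (⨅ i, (a i).order) * f.order := by gcongr
    _ ≤ _ := h3

lemma pderiv_aeval [Fintype σ] (a : σ → MvPowerSeries τ R) (p : MvPolynomial σ R) (k : τ) :
    pderiv R k (MvPolynomial.aeval a p) =
      ∑ i, MvPolynomial.aeval a (MvPolynomial.pderiv i p) * pderiv R k (a i) := by
  classical
  induction p using MvPolynomial.induction_on with
  | C r => simp
  | add p q hp hq => simp [hp, hq, add_mul, Finset.sum_add_distrib]
  | mul_X p j hp =>
    simp only [map_mul, MvPolynomial.aeval_X, Derivation.leibniz, hp, smul_eq_mul, map_add,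
      add_mul, Finset.sum_add_distrib, MvPolynomial.pderiv_X]
    simp [Pi.single_apply, apply_ite (MvPolynomial.aeval a), Finset.mul_sum, mul_assoc]

/-- The chain rule for formal power series. -/
theorem pderiv_subst [Fintype σ] (ha : ∀ i, constantCoeff (a i) = 0)
    (f : MvPowerSeries σ R) (k : τ) :
    pderiv R k (subst a f) = ∑ i, subst a (pderiv R i f) * pderiv R k (a i) := by
  classical
  have hs := hasSubst_of_constantCoeff_zero ha
  ext e
  -- the coefficient at `e` only sees a truncation of `f`, for which the chain rule is algebraic
  set p : MvPolynomial σ R := truncTotal (e.degree + 2) f with hp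
  set r : MvPowerSeries σ R := f - p with hr
  have hr0 : ∀ d : σ →₀ ℕ, d.degree < e.degree + 2 → coeff d r = 0 := by
    intro d hd
    rw [hr, map_sub, MvPolynomial.coeff_coe, hp, coeff_truncTotal _ hd, sub_self]
  have hr1 : ∀ i, ∀ d : σ →₀ ℕ, d.degree < e.degree + 1 → coeff d (pderiv R i r) = 0 := by
    intro i d hd
    rw [coeff_pderiv, hr0, zero_mul]
    simp only [map_add, Finsupp.degree_single]
    omega
  have hf : f = p + r := by rw [hr]; ring
  have hpoly : pderiv R k (subst a (p : MvPowerSeries σ R)) =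
      ∑ i, subst a (pderiv R i (p : MvPowerSeries σ R)) * pderiv R k (a i) := by
    simp only [pderiv_coe, subst_coe]
    exact pderiv_aeval a p k
  have h1 : coeff e (pderiv R k (subst a r)) = 0 := by
    rw [coeff_pderiv, coeff_subst_eq_zero_of_degree_lt ha hr0, zero_mul]
    simp
  have h2 : ∀ i, coeff e (subst a (pderiv R i r) * pderiv R k (a i)) = 0 := by
    intro i
    rw [coeff_mul]
    refine Finset.sum_eq_zero fun x hx => ?_
    rw [coeff_subst_eq_zero_of_degree_lt ha (hr1 i), zero_mul]
    rw [Finset.HasAntidiagonal.mem_antidiagonal] at hx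
    rw [← hx, map_add]; omega
  rw [hf]
  simp only [subst_add hs, map_add, add_mul, Finset.sum_add_distrib, hpoly]
  congr 1
  rw [h1, map_sum, Finset.sum_eq_zero fun i _ => h2 i]

end Chain

section Act

variable {K σ : Type*} [Field K] [Fintype σ]

/-- The derivative `∑ k, W k * ∂ G / ∂ x_k` of the power series `G` along the formal vector field
`W`. -/
noncomputable def lieDeriv (W : σ → MvPowerSeries σ K) :
    Derivation K (MvPowerSeries σ K) (MvPowerSeries σ K) :=
  ∑ k, W k • pderiv K k

lemma lieDeriv_apply (W : σ → MvPowerSeries σ K) (G : MvPowerSeries σ K) :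
    lieDeriv W G = ∑ k, W k * pderiv K k G := by
  rw [lieDeriv, ← Derivation.coeFnAddMonoidHom_apply, map_sum, Finset.sum_apply]
  rfl

lemma lieDeriv_X (W : σ → MvPowerSeries σ K) (k : σ) : lieDeriv W (X k) = W k := by
  classical
  rw [lieDeriv_apply, Finset.sum_eq_single k]
  · simp
  · intro b _ hb; simp [pderiv_X_of_ne hb.symm]
  · simp

omit [Fintype σ] in
lemma pderiv_pderiv_comm (i j : σ) (G : MvPowerSeries σ K) :
    pderiv K i (pderiv K j G) = pderiv K j (pderiv K i G) := by
  classical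
  ext d
  simp only [coeff_pderiv, add_right_comm d]
  by_cases h : i = j
  · subst h; rfl
  · simp [h, Ne.symm h]
    ring

lemma lieDeriv_lieDeriv_sub {V W : σ → MvPowerSeries σ K} (G : MvPowerSeries σ K) :
    lieDeriv V (lieDeriv W G) - lieDeriv W (lieDeriv V G) =
      lieDeriv (fun k => lieDeriv V (W k) - lieDeriv W (V k)) G := by
  have key : ∀ V W : σ → MvPowerSeries σ K, lieDeriv V (lieDeriv W G) =
      ∑ k, lieDeriv V (W k) * pderiv K k G +
        ∑ k, ∑ j, W k * (V j * pderiv K j (pderiv K k G)) := by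
    intro V W
    rw [lieDeriv_apply W, map_sum, ← Finset.sum_add_distrib]
    refine Finset.sum_congr rfl fun k _ => ?_
    rw [Derivation.leibniz, smul_eq_mul, smul_eq_mul, lieDeriv_apply V (pderiv K k G),
      Finset.mul_sum]
    ring
  have hsymm : ∑ k, ∑ j, W k * (V j * pderiv K j (pderiv K k G)) =
      ∑ k, ∑ j, V k * (W j * pderiv K j (pderiv K k G)) := by
    rw [Finset.sum_comm]
    refine Finset.sum_congr rfl fun k _ => Finset.sum_congr rfl fun j _ => ?_
    rw [pderiv_pderiv_comm k j]; ring
  rw [key V W, key W V, hsymm, lieDeriv_apply]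
  simp only [sub_mul, Finset.sum_sub_distrib]
  ring

end Act

/-- Two power series agree if they are related by a relation that respects constant terms and is
stable under all partial derivatives. -/
lemma eq_of_rel {K : Type*} [Field K] [CharZero K] {σ : Type*}
    (r : MvPowerSeries σ K → MvPowerSeries σ K → Prop)
    (h0 : ∀ a b, r a b → constantCoeff a = constantCoeff b)
    (h1 : ∀ a b, r a b → ∀ i, r (pderiv K i a) (pderiv K i b))
    {a b : MvPowerSeries σ K} (hab : r a b) : a = b := by
  have key : ∀ n : ℕ, ∀ d : σ →₀ ℕ, d.degree = n → ∀ a b, r a b →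
      coeff d a = coeff d b := by
    intro n
    induction n with
    | zero =>
      intro d hd a b hab
      rw [Finsupp.degree_eq_zero_iff] at hd
      rw [hd]
      exact h0 a b hab
    | succ n ih =>
      intro d hd a b hab
      obtain ⟨i, hi⟩ : ∃ i, d i ≠ 0 := by
        by_contra! hc
        have : d = 0 := Finsupp.ext hc
        simp [this] at hd
      have hle : Finsupp.single i 1 ≤ d := by
        rw [Finsupp.single_le_iff]; omega
      have hd' : d - Finsupp.single i 1 + Finsupp.single i 1 = d := tsub_add_cancel_of_le hle
      have h2 := ih (d - Finsupp.single i 1) (by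
        have := congrArg Finsupp.degree hd'
        simp only [map_add, Finsupp.degree_single] at this
        omega) _ _ (h1 a b hab i)
      rw [coeff_pderiv, coeff_pderiv, hd'] at h2
      exact mul_right_cancel₀ (Nat.cast_add_one_ne_zero _) h2
  ext d
  exact key _ d rfl a b hab

section Change

variable {K σ : Type*} [Field K] [Fintype σ] [DecidableEq σ]

/-- The Jacobian matrix `(∂ Ψ_i / ∂ x_j)` of a tuple of formal power series. -/
noncomputable def jacobian (Ψ : σ → MvPowerSeries σ K) : Matrix σ σ (MvPowerSeries σ K) :=
  Matrix.of fun i k => pderiv K k (Ψ i)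

/-- A formal change of coordinates: a tuple of power series without constant terms whose Jacobian
determinant is invertible. -/
structure IsFormalChange (Ψ : σ → MvPowerSeries σ K) : Prop where
  constantCoeff_eq_zero : ∀ i, constantCoeff (Ψ i) = 0
  isUnit_det : IsUnit (jacobian Ψ).det

variable {Ψ : σ → MvPowerSeries σ K}

lemma IsFormalChange.hasSubst (h : IsFormalChange Ψ) : HasSubst Ψ :=
  hasSubst_of_constantCoeff_zero h.constantCoeff_eq_zero

lemma IsFormalChange.mulVec_injective (h : IsFormalChange Ψ) {v w : σ → MvPowerSeries σ K}
    (hv : (jacobian Ψ).mulVec v = (jacobian Ψ).mulVec w) : v = w :=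
  Matrix.mulVec_injective_of_isUnit ((Matrix.isUnit_iff_isUnit_det _).2 h.isUnit_det) hv

lemma IsFormalChange.vecMul_injective (h : IsFormalChange Ψ) {v w : σ → MvPowerSeries σ K}
    (hv : Matrix.vecMul v (jacobian Ψ) = Matrix.vecMul w (jacobian Ψ)) : v = w :=
  Matrix.vecMul_injective_of_isUnit ((Matrix.isUnit_iff_isUnit_det _).2 h.isUnit_det) hv

omit [DecidableEq σ] in
lemma constantCoeff_subst_eq {a : σ → MvPowerSeries σ K} (ha : ∀ i, constantCoeff (a i) = 0)
    (f : MvPowerSeries σ K) : constantCoeff (subst a f) = constantCoeff f := by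
  have hs := hasSubst_of_constantCoeff_zero ha
  have h : f = C (constantCoeff f) + (f - C (constantCoeff f)) := by ring
  have h0 := constantCoeff_subst_eq_zero hs ha (f := f - C (constantCoeff f)) (by simp)
  conv_lhs => rw [h, subst_add hs, map_add, h0]
  simp [subst_C]

/-- The gradient of `G ∘ Ψ` is the gradient of `G`, evaluated at `Ψ`, times the Jacobian. -/
lemma IsFormalChange.pderiv_subst_eq (h : IsFormalChange Ψ) (G : MvPowerSeries σ K) :
    (fun k => pderiv K k (subst Ψ G)) =
      Matrix.vecMul (fun i => subst Ψ (pderiv K i G)) (jacobian Ψ) := by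
  funext k
  rw [pderiv_subst h.constantCoeff_eq_zero]
  rfl

/-- Composition with a formal change of coordinates is injective: its kernel is stable under all
partial derivatives and consists of series without constant term. -/
theorem IsFormalChange.eq_zero_of_subst_eq_zero [CharZero K] (h : IsFormalChange Ψ)
    {G : MvPowerSeries σ K} (hG : subst Ψ G = 0) : G = 0 := by
  have hker : ∀ G : MvPowerSeries σ K, subst Ψ G = 0 → ∀ i, subst Ψ (pderiv K i G) = 0 := by
    intro G hG i
    have h1 := h.pderiv_subst_eq G
    have h2 : (fun k => pderiv K k (subst Ψ G)) = 0 := by funext k; simp [hG]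
    rw [h2] at h1
    have h3 := h.vecMul_injective (w := 0) (h1.symm.trans (Matrix.zero_vecMul _).symm)
    exact congrFun h3 i
  refine eq_of_rel (fun a b => subst Ψ a = 0 ∧ b = 0) ?_ ?_ ⟨hG, rfl⟩
  · rintro a _ ⟨ha, rfl⟩
    rw [← constantCoeff_subst_eq h.constantCoeff_eq_zero, ha]
  · rintro a _ ⟨ha, rfl⟩ i
    exact ⟨hker a ha i, map_zero _⟩

/-- The vector field `W` is the expression of the vector field `V` in the formal coordinates
`x = Ψ y`. -/
def IsPullback (Ψ V W : σ → MvPowerSeries σ K) : Prop :=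
  (jacobian Ψ).mulVec W = fun i => subst Ψ (V i)

lemma IsFormalChange.exists_isPullback (h : IsFormalChange Ψ) (V : σ → MvPowerSeries σ K) :
    ∃ W, IsPullback Ψ V W := by
  refine ⟨(jacobian Ψ)⁻¹.mulVec fun i => subst Ψ (V i), ?_⟩
  rw [IsPullback, Matrix.mulVec_mulVec, Matrix.mul_nonsing_inv _ h.isUnit_det, Matrix.one_mulVec]

lemma IsPullback.lieDeriv_subst {V W : σ → MvPowerSeries σ K} (hW : IsPullback Ψ V W)
    (h : IsFormalChange Ψ) (G : MvPowerSeries σ K) :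
    lieDeriv W (subst Ψ G) = subst Ψ (lieDeriv V G) := by
  have h1 : lieDeriv W (subst Ψ G) = (fun k => pderiv K k (subst Ψ G)) ⬝ᵥ W := by
    rw [lieDeriv_apply]
    exact Finset.sum_congr rfl fun k _ => mul_comm _ _
  rw [h1, h.pderiv_subst_eq, ← Matrix.dotProduct_mulVec, hW, lieDeriv_apply,
    ← coe_substAlgHom h.hasSubst, map_sum]
  simp only [map_mul, dotProduct]
  exact Finset.sum_congr rfl fun k _ => mul_comm _ _

/-- Commuting vector fields still commute after a formal change of coordinates. -/
lemma IsFormalChange.lieDeriv_comm {V₁ V₂ W₁ W₂ : σ → MvPowerSeries σ K} (h : IsFormalChange Ψ)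
    (h₁ : IsPullback Ψ V₁ W₁) (h₂ : IsPullback Ψ V₂ W₂)
    (hV : ∀ k, lieDeriv V₁ (V₂ k) = lieDeriv V₂ (V₁ k)) (G : MvPowerSeries σ K) :
    lieDeriv W₁ (lieDeriv W₂ G) = lieDeriv W₂ (lieDeriv W₁ G) := by
  refine sub_eq_zero.1 ?_
  have hz : (fun k => lieDeriv W₁ (W₂ k) - lieDeriv W₂ (W₁ k)) = 0 := by
    refine h.mulVec_injective ?_
    rw [Matrix.mulVec_zero]
    funext i
    -- the bracket annihilates every coordinate function `Ψ i`
    have h0 : lieDeriv (fun k => lieDeriv W₁ (W₂ k) - lieDeriv W₂ (W₁ k)) (Ψ i) = 0 := by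
      rw [← lieDeriv_lieDeriv_sub, ← subst_X (R := K) h.hasSubst i, h₂.lieDeriv_subst h,
        h₁.lieDeriv_subst h, h₁.lieDeriv_subst h, h₂.lieDeriv_subst h, lieDeriv_X, lieDeriv_X,
        hV, sub_self]
    rw [lieDeriv_apply] at h0
    rw [Pi.zero_apply, ← h0]
    exact Finset.sum_congr rfl fun k _ => mul_comm _ _
  rw [lieDeriv_lieDeriv_sub, hz, lieDeriv_apply]
  simp

end Change

end MvPowerSeries

noncomputable section

/-! ### Taylor series of germs of analytic functions -/

namespace DoubleHopf

section Partial

variable {𝕜 : Type*} [RCLike 𝕜] {n : ℕ}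

variable (𝕜) in
/-- The partial derivative `∂ F / ∂ x_i` over the field `𝕜`. Over `ℝ` it is `partialDeriv` by
definition. -/
def partialD (i : Fin n) (F : (Fin n → 𝕜) → 𝕜) : (Fin n → 𝕜) → 𝕜 :=
  fun x => fderiv 𝕜 F x (Pi.single i 1)

lemma partialD_analyticAt {i : Fin n} {F : (Fin n → 𝕜) → 𝕜} {x : Fin n → 𝕜}
    (hF : AnalyticAt 𝕜 F x) : AnalyticAt 𝕜 (partialD 𝕜 i F) x :=
  ((ContinuousLinearMap.apply 𝕜 𝕜 (Pi.single i 1 : Fin n → 𝕜)).analyticAt _).comp hF.fderiv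

lemma partialD_congr {i : Fin n} {F G : (Fin n → 𝕜) → 𝕜} {x : Fin n → 𝕜}
    (h : F =ᶠ[𝓝 x] G) : partialD 𝕜 i F =ᶠ[𝓝 x] partialD 𝕜 i G :=
  (h.fderiv (𝕜 := 𝕜)).mono fun y hy => by simp only [partialD, hy]

lemma partialD_comm {i j : Fin n} {F : (Fin n → 𝕜) → 𝕜} {x : Fin n → 𝕜}
    (hF : AnalyticAt 𝕜 F x) :
    partialD 𝕜 i (partialD 𝕜 j F) =ᶠ[𝓝 x] partialD 𝕜 j (partialD 𝕜 i F) := by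
  filter_upwards [hF.eventually_analyticAt] with y hy
  have hs : IsSymmSndFDerivAt 𝕜 F y := hy.contDiffAt.isSymmSndFDerivAt_of_omega
  have key : ∀ i j : Fin n, partialD 𝕜 i (partialD 𝕜 j F) y =
      fderiv 𝕜 (fderiv 𝕜 F) y (Pi.single i 1) (Pi.single j 1) := by
    intro i j
    have hd : DifferentiableAt 𝕜 (fderiv 𝕜 F) y := hy.fderiv.differentiableAt
    unfold partialD
    rw [fderiv_clm_apply hd (differentiableAt_const _)]
    simp
  rw [key, key]
  exact hs _ _

lemma fderiv_apply_eq_sum (F : (Fin n → 𝕜) → 𝕜) (x v : Fin n → 𝕜) :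
    fderiv 𝕜 F x v = ∑ k, v k * partialD 𝕜 k F x := by
  conv_lhs => rw [pi_eq_sum_univ' v, map_sum]
  refine Finset.sum_congr rfl fun k _ => ?_
  rw [map_smul, smul_eq_mul, partialD]

/-- The iterated partial derivative `∂_0^{d_0} ⋯ ∂_{n-1}^{d_{n-1}} F` over the field `𝕜`. -/
def iterPartial (d : Fin n →₀ ℕ) (F : (Fin n → 𝕜) → 𝕜) : (Fin n → 𝕜) → 𝕜 :=
  (List.finRange n).foldr (fun i G => (partialD 𝕜 i)^[d i] G) F

lemma iterate_partialD_analyticAt {i : Fin n} {F : (Fin n → 𝕜) → 𝕜} {x : Fin n → 𝕜}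
    (hF : AnalyticAt 𝕜 F x) (m : ℕ) : AnalyticAt 𝕜 ((partialD 𝕜 i)^[m] F) x := by
  induction m with
  | zero => exact hF
  | succ m ih => rw [Function.iterate_succ_apply']; exact partialD_analyticAt ih

lemma iterate_partialD_congr {i : Fin n} {F G : (Fin n → 𝕜) → 𝕜} {x : Fin n → 𝕜}
    (h : F =ᶠ[𝓝 x] G) (m : ℕ) : (partialD 𝕜 i)^[m] F =ᶠ[𝓝 x] (partialD 𝕜 i)^[m] G := by
  induction m with
  | zero => exact h
  | succ m ih => simp only [Function.iterate_succ_apply']; exact partialD_congr ih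

lemma iterate_partialD_comm {i j : Fin n} {F : (Fin n → 𝕜) → 𝕜} {x : Fin n → 𝕜}
    (hF : AnalyticAt 𝕜 F x) (m : ℕ) :
    (partialD 𝕜 i)^[m] (partialD 𝕜 j F) =ᶠ[𝓝 x] partialD 𝕜 j ((partialD 𝕜 i)^[m] F) := by
  induction m with
  | zero => rfl
  | succ m ih =>
    simp only [Function.iterate_succ_apply']
    exact (partialD_congr ih).trans (partialD_comm (iterate_partialD_analyticAt hF m))

section Foldr

variable {x : Fin n → 𝕜} (d : Fin n →₀ ℕ) (l : List (Fin n))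

lemma foldr_partialD_analyticAt {F : (Fin n → 𝕜) → 𝕜} (hF : AnalyticAt 𝕜 F x) :
    AnalyticAt 𝕜 (l.foldr (fun i G => (partialD 𝕜 i)^[d i] G) F) x := by
  induction l with
  | nil => exact hF
  | cons i l ih => exact iterate_partialD_analyticAt ih _

lemma foldr_partialD_congr {F G : (Fin n → 𝕜) → 𝕜} (h : F =ᶠ[𝓝 x] G) :
    l.foldr (fun i G => (partialD 𝕜 i)^[d i] G) F =ᶠ[𝓝 x]
      l.foldr (fun i G => (partialD 𝕜 i)^[d i] G) G := by
  induction l with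
  | nil => exact h
  | cons i l ih => exact iterate_partialD_congr ih _

lemma foldr_partialD_comm {F : (Fin n → 𝕜) → 𝕜} (hF : AnalyticAt 𝕜 F x) (j : Fin n) :
    l.foldr (fun i G => (partialD 𝕜 i)^[d i] G) (partialD 𝕜 j F) =ᶠ[𝓝 x]
      partialD 𝕜 j (l.foldr (fun i G => (partialD 𝕜 i)^[d i] G) F) := by
  induction l with
  | nil => rfl
  | cons i l ih =>
    exact (iterate_partialD_congr ih _).trans
      (iterate_partialD_comm (foldr_partialD_analyticAt d l hF) _)

lemma foldr_partialD_add_single_of_notMem {F : (Fin n → 𝕜) → 𝕜} {j : Fin n} (hj : j ∉ l) :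
    l.foldr (fun i G => (partialD 𝕜 i)^[(d + Finsupp.single j 1 : Fin n →₀ ℕ) i] G) F =
      l.foldr (fun i G => (partialD 𝕜 i)^[d i] G) F := by
  induction l with
  | nil => rfl
  | cons i l ih =>
    rw [List.mem_cons, not_or] at hj
    simp only [List.foldr_cons, ih hj.2]
    simp [Ne.symm hj.1]

lemma foldr_partialD_add_single {F : (Fin n → 𝕜) → 𝕜} (hF : AnalyticAt 𝕜 F x) {j : Fin n}
    (hl : l.Nodup) (hj : j ∈ l) :
    l.foldr (fun i G => (partialD 𝕜 i)^[(d + Finsupp.single j 1 : Fin n →₀ ℕ) i] G) F =ᶠ[𝓝 x]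
      l.foldr (fun i G => (partialD 𝕜 i)^[d i] G) (partialD 𝕜 j F) := by
  induction l with
  | nil => simp at hj
  | cons i l ih =>
    rw [List.nodup_cons] at hl
    simp only [List.foldr_cons]
    by_cases hij : j = i
    · subst hij
      rw [foldr_partialD_add_single_of_notMem d l hl.1]
      have h1 : (d + Finsupp.single j 1 : Fin n →₀ ℕ) j = d j + 1 := by simp
      rw [h1, Function.iterate_succ_apply]
      exact iterate_partialD_congr (foldr_partialD_comm d l hF j).symm _
    · have h1 : (d + Finsupp.single j 1 : Fin n →₀ ℕ) i = d i := by simp [hij]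
      rw [h1]
      exact iterate_partialD_congr (ih hl.2 ((List.mem_cons.1 hj).resolve_left hij)) _

end Foldr

/-- The Taylor series at the origin over the field `𝕜`. Over `ℝ` it is `taylorSeries` by
definition. -/
def taylor (F : (Fin n → 𝕜) → 𝕜) : MvPowerSeries (Fin n) 𝕜 :=
  fun d => iterPartial d F 0 / ∏ i, ((d i).factorial : 𝕜)

lemma coeff_taylor (F : (Fin n → 𝕜) → 𝕜) (d : Fin n →₀ ℕ) :
    MvPowerSeries.coeff d (taylor F) = iterPartial d F 0 / ∏ i, ((d i).factorial : 𝕜) := rfl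

lemma taylor_congr {F G : (Fin n → 𝕜) → 𝕜} (h : F =ᶠ[𝓝 0] G) : taylor F = taylor G := by
  ext d
  rw [coeff_taylor, coeff_taylor]
  congr 1
  exact (foldr_partialD_congr d _ h).eq_of_nhds

lemma constantCoeff_taylor (F : (Fin n → 𝕜) → 𝕜) :
    MvPowerSeries.constantCoeff (taylor F) = F 0 := by
  rw [← MvPowerSeries.coeff_zero_eq_constantCoeff_apply, coeff_taylor, iterPartial]
  have : ∀ l : List (Fin n),
      l.foldr (fun i G => (partialD 𝕜 i)^[(0 : Fin n →₀ ℕ) i] G) F = F := by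
    intro l
    induction l with
    | nil => rfl
    | cons i l ih => simpa only [List.foldr_cons] using! ih
  rw [this]
  simp

lemma pderiv_taylor {F : (Fin n → 𝕜) → 𝕜} (hF : AnalyticAt 𝕜 F 0) (j : Fin n) :
    MvPowerSeries.pderiv 𝕜 j (taylor F) = taylor (partialD 𝕜 j F) := by
  ext d
  rw [MvPowerSeries.coeff_pderiv, coeff_taylor, coeff_taylor]
  have h1 : iterPartial (d + Finsupp.single j 1 : Fin n →₀ ℕ) F 0 = iterPartial d (partialD 𝕜 j F) 0 :=
    (foldr_partialD_add_single d _ hF (List.nodup_finRange n)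
      (List.mem_finRange j)).eq_of_nhds
  have h2 : ∏ i, (((d + Finsupp.single j 1 : Fin n →₀ ℕ) i).factorial : 𝕜) =
      (d j + 1) * ∏ i, ((d i).factorial : 𝕜) := by
    rw [← Finset.mul_prod_erase _ _ (Finset.mem_univ j),
      ← Finset.mul_prod_erase Finset.univ (fun i => ((d i).factorial : 𝕜)) (Finset.mem_univ j),
      ← mul_assoc]
    congr 1
    · simp [Nat.factorial_succ]
    · refine Finset.prod_congr rfl fun i hi => ?_
      have := Finset.ne_of_mem_erase hi
      simp [this.symm]
  rw [h1, h2]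
  have h3 : (d j + 1 : 𝕜) ≠ 0 := Nat.cast_add_one_ne_zero _
  have h4 : ∏ i, ((d i).factorial : 𝕜) ≠ 0 :=
    Finset.prod_ne_zero_iff.2 fun i _ => Nat.cast_ne_zero.2 (Nat.factorial_ne_zero _)
  field_simp

end Partial

section Taylor

variable {𝕜 : Type*} [RCLike 𝕜] {n : ℕ} {F G : (Fin n → 𝕜) → 𝕜}

lemma partialD_add (hF : AnalyticAt 𝕜 F 0) (hG : AnalyticAt 𝕜 G 0) (i : Fin n) :
    partialD 𝕜 i (F + G) =ᶠ[𝓝 0] partialD 𝕜 i F + partialD 𝕜 i G := by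
  filter_upwards [hF.eventually_analyticAt, hG.eventually_analyticAt] with x hx hy
  simp [partialD, fderiv_add hx.differentiableAt hy.differentiableAt]

lemma partialD_mul (hF : AnalyticAt 𝕜 F 0) (hG : AnalyticAt 𝕜 G 0) (i : Fin n) :
    partialD 𝕜 i (F * G) =ᶠ[𝓝 0] F * partialD 𝕜 i G + G * partialD 𝕜 i F := by
  filter_upwards [hF.eventually_analyticAt, hG.eventually_analyticAt] with x hx hy
  simp [partialD, fderiv_mul hx.differentiableAt hy.differentiableAt]

lemma taylor_add (hF : AnalyticAt 𝕜 F 0) (hG : AnalyticAt 𝕜 G 0) :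
    taylor (F + G) = taylor F + taylor G := by
  refine MvPowerSeries.eq_of_rel (fun a b => ∃ F G : (Fin n → 𝕜) → 𝕜, AnalyticAt 𝕜 F 0 ∧
    AnalyticAt 𝕜 G 0 ∧ a = taylor (F + G) ∧ b = taylor F + taylor G) ?_ ?_ ⟨F, G, hF, hG, rfl, rfl⟩
  · rintro _ _ ⟨F, G, hF, hG, rfl, rfl⟩
    simp [constantCoeff_taylor]
  · rintro _ _ ⟨F, G, hF, hG, rfl, rfl⟩ i
    refine ⟨partialD 𝕜 i F, partialD 𝕜 i G, partialD_analyticAt hF, partialD_analyticAt hG, ?_, ?_⟩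
    · rw [pderiv_taylor (hF.add hG), taylor_congr (partialD_add hF hG i)]
    · rw [map_add, pderiv_taylor hF, pderiv_taylor hG]

/-- The Taylor series of a product is the product of the Taylor series. -/
lemma taylor_mul (hF : AnalyticAt 𝕜 F 0) (hG : AnalyticAt 𝕜 G 0) :
    taylor (F * G) = taylor F * taylor G := by
  -- pairs of equal-length sums of products, so that the relation is stable under the Leibniz rule
  refine MvPowerSeries.eq_of_rel (fun a b => ∃ l : List (((Fin n → 𝕜) → 𝕜) × ((Fin n → 𝕜) → 𝕜)),
    (∀ p ∈ l, AnalyticAt 𝕜 p.1 0 ∧ AnalyticAt 𝕜 p.2 0) ∧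
    a = (l.map fun p => taylor (p.1 * p.2)).sum ∧
    b = (l.map fun p => taylor p.1 * taylor p.2).sum) ?_ ?_
    ⟨[(F, G)], by simpa using ⟨hF, hG⟩, by simp, by simp⟩
  · rintro _ _ ⟨l, -, rfl, rfl⟩
    rw [map_list_sum, map_list_sum]
    simp [constantCoeff_taylor, Function.comp_def]
  · rintro _ _ ⟨l, hl, rfl, rfl⟩ i
    refine ⟨l.map (fun p => (p.1, partialD 𝕜 i p.2)) ++ l.map (fun p => (p.2, partialD 𝕜 i p.1)),
      ?_, ?_, ?_⟩
    · intro p hp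
      simp only [List.mem_append, List.mem_map] at hp
      obtain ⟨q, hq, rfl⟩ | ⟨q, hq, rfl⟩ := hp
      · exact ⟨(hl q hq).1, partialD_analyticAt (hl q hq).2⟩
      · exact ⟨(hl q hq).2, partialD_analyticAt (hl q hq).1⟩
    · rw [map_list_sum, List.map_append, List.sum_append, List.map_map, List.map_map, List.map_map,
        ← List.sum_map_add]
      refine congrArg _ (List.map_congr_left fun p hp => ?_)
      obtain ⟨h1, h2⟩ := hl p hp
      simp only [Function.comp]
      rw [pderiv_taylor (h1.mul h2), taylor_congr (partialD_mul h1 h2 i),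
        taylor_add (h1.mul (partialD_analyticAt h2)) (h2.mul (partialD_analyticAt h1))]
    · rw [map_list_sum, List.map_append, List.sum_append, List.map_map, List.map_map, List.map_map,
        ← List.sum_map_add]
      refine congrArg _ (List.map_congr_left fun p hp => ?_)
      obtain ⟨h1, h2⟩ := hl p hp
      simp only [Function.comp, Derivation.leibniz, smul_eq_mul, pderiv_taylor h1, pderiv_taylor h2]

lemma taylor_const (c : 𝕜) : taylor (fun _ : Fin n → 𝕜 => c) = MvPowerSeries.C c := by
  refine MvPowerSeries.eq_of_rel (fun a b => ∃ c : 𝕜, a = taylor (fun _ : Fin n → 𝕜 => c) ∧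
    b = MvPowerSeries.C c) ?_ ?_ ⟨c, rfl, rfl⟩
  · rintro _ _ ⟨c, rfl, rfl⟩
    simp [constantCoeff_taylor]
  · rintro _ _ ⟨c, rfl, rfl⟩ i
    refine ⟨0, ?_, by simp⟩
    rw [pderiv_taylor analyticAt_const]
    congr 1
    funext x
    simp [partialD]

lemma taylor_sum {ι : Type*} (s : Finset ι) {F : ι → (Fin n → 𝕜) → 𝕜}
    (hF : ∀ i ∈ s, AnalyticAt 𝕜 (F i) 0) : taylor (∑ i ∈ s, F i) = ∑ i ∈ s, taylor (F i) := by
  classical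
  induction s using Finset.induction_on with
  | empty => simpa using! taylor_const (n := n) (0 : 𝕜)
  | insert a s ha ih =>
    rw [Finset.forall_mem_insert] at hF
    rw [Finset.sum_insert ha, Finset.sum_insert ha, taylor_add hF.1, ih hF.2]
    exact Finset.analyticAt_sum _ hF.2

lemma taylor_prod {ι : Type*} (s : Finset ι) {F : ι → (Fin n → 𝕜) → 𝕜}
    (hF : ∀ i ∈ s, AnalyticAt 𝕜 (F i) 0) : taylor (∏ i ∈ s, F i) = ∏ i ∈ s, taylor (F i) := by
  classical
  induction s using Finset.induction_on with
  | empty => simpa using! taylor_const (n := n) (1 : 𝕜)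
  | insert a s ha ih =>
    rw [Finset.forall_mem_insert] at hF
    rw [Finset.prod_insert ha, Finset.prod_insert ha, taylor_mul hF.1, ih hF.2]
    exact Finset.analyticAt_prod _ hF.2

/-- An analytic germ with vanishing Taylor series vanishes. -/
theorem eventually_eq_zero_of_taylor_eq_zero (hF : AnalyticAt 𝕜 F 0) (h : taylor F = 0) :
    ∀ᶠ x in 𝓝 0, F x = 0 := by
  have key : ∀ m : ℕ, ∀ F : (Fin n → 𝕜) → 𝕜, AnalyticAt 𝕜 F 0 → taylor F = 0 →
      iteratedFDeriv 𝕜 m F 0 = 0 := by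
    intro m
    induction m with
    | zero =>
      intro F _ h
      ext v
      rw [iteratedFDeriv_zero_apply, ← constantCoeff_taylor F, h]
      simp
    | succ m ih =>
      intro F hF h
      ext v
      rw [iteratedFDeriv_succ_apply_right]
      have h1 : (fun y => fderiv 𝕜 F y) = fun y => ∑ k, (ContinuousLinearMap.smulRight
          (1 : 𝕜 →L[𝕜] 𝕜) (ContinuousLinearMap.proj (R := 𝕜) (φ := fun _ : Fin n => 𝕜) k))
            (partialD 𝕜 k F y) := by
        funext y
        ext w
        rw [fderiv_apply_eq_sum]
        simp [mul_comm]
      have h2 : iteratedFDeriv 𝕜 m (fun y => fderiv 𝕜 F y) 0 = 0 := by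
        rw [h1]
        rw [iteratedFDeriv_fun_sum_apply]
        · rw [Finset.sum_eq_zero]
          intro k _
          have hk : AnalyticAt 𝕜 (partialD 𝕜 k F) 0 := partialD_analyticAt hF
          have h3 := ContinuousLinearMap.iteratedFDeriv_comp_left (ContinuousLinearMap.smulRight
            (1 : 𝕜 →L[𝕜] 𝕜) (ContinuousLinearMap.proj (R := 𝕜) (φ := fun _ : Fin n => 𝕜) k))
            (hk.contDiffAt (n := m)) le_rfl
          refine h3.trans ?_
          rw [ih _ hk (by rw [← pderiv_taylor hF, h, map_zero])]
          ext; simp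
        · intro k _
          exact (ContinuousLinearMap.contDiff _).contDiffAt.comp _
            (partialD_analyticAt hF).contDiffAt
      rw [h2]; rfl
  obtain ⟨p, r, hp⟩ := hF
  filter_upwards [Metric.eball_mem_nhds (0 : Fin n → 𝕜) hp.r_pos] with x hx
  have h1 := hp.hasSum_iteratedFDeriv hx
  rw [zero_add] at h1
  refine h1.unique ?_
  simp [key _ F ⟨p, r, hp⟩ h, hasSum_zero]

end Taylor

section Complexification

variable {n : ℕ}

lemma partialD_ofReal {F : (Fin n → ℂ) → ℂ} {f : (Fin n → ℝ) → ℝ} (hF : AnalyticAt ℂ F 0)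
    (hf : AnalyticAt ℝ f 0) (h : ∀ᶠ x in 𝓝 (0 : Fin n → ℝ), F (fun i => (x i : ℂ)) = f x)
    (j : Fin n) : ∀ᶠ x in 𝓝 (0 : Fin n → ℝ),
      partialD ℂ j F (fun i => (x i : ℂ)) = (partialD ℝ j f x : ℝ) := by
  let ι : (Fin n → ℝ) →L[ℝ] (Fin n → ℂ) :=
    ContinuousLinearMap.pi fun i => Complex.ofRealCLM.comp (ContinuousLinearMap.proj i)
  have hι : ∀ x, ι x = fun i => (x i : ℂ) := fun x => rfl
  have hFι : ∀ᶠ x in 𝓝 (0 : Fin n → ℝ), AnalyticAt ℂ F (ι x) := by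
    have : Tendsto ι (𝓝 0) (𝓝 0) := by simpa using ι.continuous.tendsto 0
    exact this.eventually hF.eventually_analyticAt
  filter_upwards [h.eventually_nhds, hFι, hf.eventually_analyticAt] with x h1 h2 h3
  have h4 : (fun y => F (ι y)) =ᶠ[𝓝 x] fun y => Complex.ofRealCLM (f y) := h1
  have h5 : HasFDerivAt (fun y => F (ι y)) (((fderiv ℂ F (ι x)).restrictScalars ℝ).comp ι) x :=
    (h2.differentiableAt.hasFDerivAt.restrictScalars ℝ).comp x ι.hasFDerivAt
  have h6 : HasFDerivAt (fun y => Complex.ofRealCLM (f y))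
      (Complex.ofRealCLM.comp (fderiv ℝ f x)) x :=
    Complex.ofRealCLM.hasFDerivAt.comp x h3.differentiableAt.hasFDerivAt
  have h7 := congrArg (fun L : (Fin n → ℝ) →L[ℝ] ℂ => L (Pi.single j 1))
    (h5.unique (h6.congr_of_eventuallyEq h4))
  have h8 : ι (Pi.single j 1) = Pi.single j 1 := by
    funext i
    rw [hι]
    by_cases hij : i = j
    · subst hij; simp
    · simp [hij]
  simpa [h8, hι, partialD] using h7

/-- The Taylor series of the complexification of a real-analytic function is the complexified
Taylor series. -/
lemma taylor_complexification {F : (Fin n → ℂ) → ℂ} {f : (Fin n → ℝ) → ℝ}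
    (hF : AnalyticAt ℂ F 0) (hf : AnalyticAt ℝ f 0)
    (h : ∀ᶠ x in 𝓝 (0 : Fin n → ℝ), F (fun i => (x i : ℂ)) = f x) :
    taylor F = MvPowerSeries.map Complex.ofRealHom (taylorSeries f) := by
  refine MvPowerSeries.eq_of_rel (fun a b => ∃ (F : (Fin n → ℂ) → ℂ) (f : (Fin n → ℝ) → ℝ),
    AnalyticAt ℂ F 0 ∧ AnalyticAt ℝ f 0 ∧
    (∀ᶠ x in 𝓝 (0 : Fin n → ℝ), F (fun i => (x i : ℂ)) = f x) ∧ a = taylor F ∧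
    b = MvPowerSeries.map Complex.ofRealHom (taylor f)) ?_ ?_ ⟨F, f, hF, hf, h, rfl, rfl⟩
  · rintro _ _ ⟨F, f, hF, hf, h, rfl, rfl⟩
    rw [constantCoeff_taylor, MvPowerSeries.constantCoeff_map, constantCoeff_taylor]
    simpa using! h.self_of_nhds
  · rintro _ _ ⟨F, f, hF, hf, h, rfl, rfl⟩ i
    refine ⟨partialD ℂ i F, partialD ℝ i f, partialD_analyticAt hF, partialD_analyticAt hf,
      partialD_ofReal hF hf h i, pderiv_taylor hF i, ?_⟩
    rw [← pderiv_taylor hf]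
    ext d
    simp [MvPowerSeries.coeff_pderiv]

end Complexification

end DoubleHopf

end

noncomputable section

/-! ### The normal form in complex coordinates -/

namespace DoubleHopf

open MvPowerSeries

/-- The monomials `z₁ w₁` and `z₂ w₂` in the complex coordinates `(z₁, w₁, z₂, w₂)`. -/
def radii : Fin 2 → MvPowerSeries (Fin 4) ℂ := ![X 0 * X 1, X 2 * X 3]

/-- The power series `g (z₁ w₁, z₂ w₂)`. -/
def inRadii (g : MvPowerSeries (Fin 2) ℂ) : MvPowerSeries (Fin 4) ℂ := subst radii g

lemma radii_zero : radii 0 = X 0 * X 1 := rfl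

lemma radii_one : radii 1 = X 2 * X 3 := rfl

lemma two_eq_C {σ : Type*} : (2 : MvPowerSeries σ ℂ) = C 2 := (map_ofNat C 2).symm

lemma mvX_ne_zero {σ : Type*} (i : σ) : (X i : MvPowerSeries σ ℂ) ≠ 0 := fun h => by
  have := congrArg (coeff (Finsupp.single i 1)) h
  rw [coeff_index_single_self_X, map_zero] at this
  exact one_ne_zero this

lemma constantCoeff_radii (i : Fin 2) : constantCoeff (radii i) = 0 := by
  fin_cases i <;> simp [radii]

lemma hasSubst_radii : HasSubst radii := hasSubst_of_constantCoeff_zero constantCoeff_radii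

lemma inRadii_add (g h : MvPowerSeries (Fin 2) ℂ) : inRadii (g + h) = inRadii g + inRadii h :=
  subst_add hasSubst_radii g h

lemma inRadii_sub (g h : MvPowerSeries (Fin 2) ℂ) : inRadii (g - h) = inRadii g - inRadii h :=
  subst_sub hasSubst_radii g h

lemma inRadii_zero : inRadii 0 = 0 := by
  rw [inRadii, ← coe_substAlgHom hasSubst_radii, map_zero]

lemma inRadii_neg (g : MvPowerSeries (Fin 2) ℂ) : inRadii (-g) = -inRadii g := by
  have h := inRadii_add (-g) g
  rw [neg_add_cancel, inRadii_zero] at h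
  exact eq_neg_of_add_eq_zero_left h.symm

lemma inRadii_mul (g h : MvPowerSeries (Fin 2) ℂ) : inRadii (g * h) = inRadii g * inRadii h :=
  subst_mul hasSubst_radii g h

lemma inRadii_C (c : ℂ) : inRadii (C c) = C c := subst_C c

lemma inRadii_X (i : Fin 2) : inRadii (X i) = radii i := subst_X hasSubst_radii i

/-- The exponent of the monomial `(z₁ w₁) ^ a (z₂ w₂) ^ b`. -/
def quadExp (d : Fin 2 →₀ ℕ) : Fin 4 →₀ ℕ :=
  Finsupp.single 0 (d 0) + Finsupp.single 1 (d 0) + Finsupp.single 2 (d 1) + Finsupp.single 3 (d 1)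

lemma quadExp_apply (d : Fin 2 →₀ ℕ) :
    quadExp d 0 = d 0 ∧ quadExp d 1 = d 0 ∧ quadExp d 2 = d 1 ∧ quadExp d 3 = d 1 := by
  simp [quadExp]

/-- The exponents of monomials in `z₁ w₁` and `z₂ w₂`, that is, of weight zero under the torus
action generated by the linear part of the normal form. -/
def IsBalanced (e : Fin 4 →₀ ℕ) : Prop := e 0 = e 1 ∧ e 2 = e 3

lemma isBalanced_quadExp (d : Fin 2 →₀ ℕ) : IsBalanced (quadExp d) := by
  obtain ⟨h0, h1, h2, h3⟩ := quadExp_apply d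
  exact ⟨h0.trans h1.symm, h2.trans h3.symm⟩

lemma IsBalanced.exists_quadExp {e : Fin 4 →₀ ℕ} (he : IsBalanced e) : ∃ d, quadExp d = e := by
  refine ⟨Finsupp.single 0 (e 0) + Finsupp.single 1 (e 2), ?_⟩
  ext i
  have h := quadExp_apply (Finsupp.single 0 (e 0) + Finsupp.single 1 (e 2))
  simp only [Finsupp.add_apply, Finsupp.single_apply] at h
  obtain ⟨h0, h1, h2, h3⟩ := h
  obtain ⟨e1, e2⟩ := he
  fin_cases i
  · simpa using h0
  · simpa [e1] using h1
  · simpa using h2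
  · simpa [e2] using h3

lemma quadExp_injective : Function.Injective quadExp := by
  intro d d' h
  obtain ⟨h0, -, h2, -⟩ := quadExp_apply d
  obtain ⟨h0', -, h2', -⟩ := quadExp_apply d'
  ext i
  fin_cases i
  · simp only [Fin.zero_eta]; rw [← h0, ← h0', h]
  · simp only [Fin.mk_one]; rw [← h2, ← h2', h]

lemma prod_radii (d : Fin 2 →₀ ℕ) :
    (d.prod fun s e => radii s ^ e) = monomial (quadExp d) (1 : ℂ) := by
  rw [Finsupp.prod_fintype _ _ (by simp), Fin.prod_univ_two, quadExp]
  simp only [radii, Matrix.cons_val_zero, Matrix.cons_val_one, mul_pow, X_pow_eq,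
    monomial_mul_monomial, mul_one, add_assoc]

lemma coeff_inRadii_quadExp (g : MvPowerSeries (Fin 2) ℂ) (d : Fin 2 →₀ ℕ) :
    coeff (quadExp d) (inRadii g) = coeff d g := by
  classical
  rw [inRadii, coeff_subst hasSubst_radii, finsum_eq_single _ d]
  · rw [prod_radii, coeff_monomial_same, smul_eq_mul, mul_one]
  · intro d' hd'
    rw [prod_radii, coeff_monomial, if_neg, smul_zero]
    exact fun h => hd' (quadExp_injective h.symm)

lemma coeff_inRadii_of_not_isBalanced (g : MvPowerSeries (Fin 2) ℂ) {e : Fin 4 →₀ ℕ}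
    (he : ¬ IsBalanced e) : coeff e (inRadii g) = 0 := by
  classical
  rw [inRadii, coeff_subst hasSubst_radii]
  refine finsum_eq_zero_of_forall_eq_zero fun d => ?_
  rw [prod_radii, coeff_monomial, if_neg, smul_zero]
  rintro rfl
  exact he (isBalanced_quadExp d)

lemma inRadii_injective : Function.Injective inRadii := by
  intro g h hgh
  ext d
  rw [← coeff_inRadii_quadExp, hgh, coeff_inRadii_quadExp]

lemma exists_eq_inRadii {u : MvPowerSeries (Fin 4) ℂ}
    (hu : ∀ e, ¬ IsBalanced e → coeff e u = 0) : ∃ g, u = inRadii g := by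
  let g : MvPowerSeries (Fin 2) ℂ := fun d => coeff (quadExp d) u
  have hg : ∀ d, coeff d g = coeff (quadExp d) u := fun _ => rfl
  refine ⟨g, ?_⟩
  ext e
  by_cases he : IsBalanced e
  · obtain ⟨d, rfl⟩ := he.exists_quadExp
    rw [coeff_inRadii_quadExp, hg]
  · rw [hu e he, coeff_inRadii_of_not_isBalanced _ he]

lemma coeff_X_mul_pderiv {K σ : Type*} [Field K] (k : σ) (u : MvPowerSeries σ K)
    (e : σ →₀ ℕ) : coeff e (X k * pderiv K k u) = e k * coeff e u := by
  classical
  by_cases hk : e k = 0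
  · rw [hk, Nat.cast_zero, zero_mul]
    exact X_dvd_iff.1 (dvd_mul_right _ _) e hk
  · have hle : Finsupp.single k 1 ≤ e := by rw [Finsupp.single_le_iff]; omega
    obtain ⟨e', rfl⟩ := exists_add_of_le hle
    rw [X, coeff_add_monomial_mul, one_mul, coeff_pderiv, add_comm e']
    simp only [Finsupp.add_apply, Finsupp.single_eq_same]
    push_cast
    ring

lemma coeff_inRadii_mul (a : MvPowerSeries (Fin 2) ℂ) {H : MvPowerSeries (Fin 4) ℂ}
    {e : Fin 4 →₀ ℕ} (he : ¬ IsBalanced e)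
    (hH : ∀ e' : Fin 4 →₀ ℕ, e'.degree < e.degree → ¬ IsBalanced e' → coeff e' H = 0) :
    coeff e (inRadii a * H) = constantCoeff a * coeff e H := by
  classical
  rw [coeff_mul, Finset.sum_eq_single (0, e)]
  · have h0 : quadExp 0 = 0 := by simp [quadExp]
    have := coeff_inRadii_quadExp a 0
    rw [h0] at this
    simp only [this, coeff_zero_eq_constantCoeff_apply]
  · rintro ⟨x, y⟩ hxy hne
    rw [Finset.HasAntidiagonal.mem_antidiagonal] at hxy
    simp only at hxy ⊢
    by_cases hx : IsBalanced x
    · rw [hH y, mul_zero]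
      · have hx0 : x ≠ 0 := by
          rintro rfl
          rw [zero_add] at hxy
          exact hne (by rw [hxy])
        have : x.degree ≠ 0 := by rwa [Ne, Finsupp.degree_eq_zero_iff]
        rw [← hxy, map_add]; omega
      · intro hy
        refine he ?_
        rw [← hxy]
        exact ⟨by simp [hx.1, hy.1], by simp [hx.2, hy.2]⟩
    · rw [coeff_inRadii_of_not_isBalanced a hx, zero_mul]
  · intro h
    exact absurd (Finset.HasAntidiagonal.mem_antidiagonal.2 (zero_add e)) h

/-- If a tuple `u` of power series satisfies a linear system `X u = M u` along a vector field `X` in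
normal form with nonresonant linear part, where `M` has no constant terms, then each `u i` is a
power series in `z₁ w₁` and `z₂ w₂`: an unbalanced monomial of least degree would be multiplied by
its nonzero eigenvalue on the left-hand side and does not appear on the right-hand side. -/
theorem exists_eq_inRadii_of_lieDeriv {ι : Type*} [Fintype ι] {A : Fin 4 → MvPowerSeries (Fin 2) ℂ}
    (hA : ∀ e : Fin 4 →₀ ℕ, ∑ k, constantCoeff (A k) * e k = 0 → IsBalanced e)
    {M : ι → ι → MvPowerSeries (Fin 2) ℂ} (hM : ∀ i j, constantCoeff (M i j) = 0)
    {u : ι → MvPowerSeries (Fin 4) ℂ}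
    (hu : ∀ i, lieDeriv (fun k => inRadii (A k) * X k) (u i) = ∑ j, inRadii (M i j) * u j) (i : ι) :
    ∃ g, u i = inRadii g := by
  have key : ∀ n : ℕ, ∀ e : Fin 4 →₀ ℕ, e.degree = n → ¬ IsBalanced e → ∀ i, coeff e (u i) = 0 := by
    intro n
    induction n using Nat.strong_induction_on with
    | _ n ih =>
      intro e hen he i
      have hlow : ∀ i, ∀ e' : Fin 4 →₀ ℕ, e'.degree < e.degree → ¬ IsBalanced e' →
          coeff e' (u i) = 0 := fun i e' h1 h2 => ih _ (hen ▸ h1) e' rfl h2 i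
      have h1 := congrArg (coeff e) (hu i)
      rw [lieDeriv_apply, map_sum, map_sum] at h1
      rw [Finset.sum_eq_zero (s := Finset.univ) (f := fun j => coeff e (inRadii (M i j) * u j))] at h1
      · have h2 : ∀ k, coeff e (inRadii (A k) * X k * pderiv ℂ k (u i)) =
            constantCoeff (A k) * e k * coeff e (u i) := by
          intro k
          rw [mul_assoc, coeff_inRadii_mul _ he, coeff_X_mul_pderiv, mul_assoc]
          intro e' h3 h4
          rw [coeff_X_mul_pderiv, hlow i e' h3 h4, mul_zero]
        simp only [h2, ← Finset.sum_mul] at h1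
        exact (mul_eq_zero.1 h1).resolve_left fun h => he (hA e h)
      · intro j _
        rw [coeff_inRadii_mul _ he (hlow j), hM, zero_mul]
  exact exists_eq_inRadii fun e he => key _ e rfl he i

lemma lieDeriv_inRadii (W : Fin 4 → MvPowerSeries (Fin 4) ℂ) (g : MvPowerSeries (Fin 2) ℂ) :
    lieDeriv W (inRadii g) = ∑ a, inRadii (pderiv ℂ a g) * lieDeriv W (radii a) := by
  simp only [lieDeriv_apply, inRadii, pderiv_subst constantCoeff_radii, Finset.mul_sum]
  rw [Finset.sum_comm]
  exact Finset.sum_congr rfl fun a _ => Finset.sum_congr rfl fun k _ => by ring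

/-- The derivation `p y₁ ∂₁ + q y₂ ∂₂`: half the derivative along the planar vector field
`r₁' = p r₁`, `r₂' = q r₂`, expressed in `y₁ = r₁ ^ 2` and `y₂ = r₂ ^ 2`. -/
def logDeriv (p q : MvPowerSeries (Fin 2) ℂ) :
    Derivation ℂ (MvPowerSeries (Fin 2) ℂ) (MvPowerSeries (Fin 2) ℂ) :=
  (p * X 0) • pderiv ℂ 0 + (q * X 1) • pderiv ℂ 1

lemma logDeriv_apply (p q g : MvPowerSeries (Fin 2) ℂ) :
    logDeriv p q g = p * (X 0 * pderiv ℂ 0 g) + q * (X 1 * pderiv ℂ 1 g) := by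
  simp [logDeriv, mul_assoc]

/-- The diagonal coefficients of the normal form in the coordinates `z = x₁ + i x₂`,
`w = x₁ - i x₂`. -/
def diagCoeff (ω₁ ω₂ : ℝ) (h₁ h₂ h₃ h₄ : MvPowerSeries (Fin 2) ℂ) :
    Fin 4 → MvPowerSeries (Fin 2) ℂ :=
  ![C (Complex.I * ω₁) + h₁ + C Complex.I * h₂, -C (Complex.I * ω₁) + h₁ - C Complex.I * h₂,
    C (Complex.I * ω₂) + h₃ + C Complex.I * h₄, -C (Complex.I * ω₂) + h₃ - C Complex.I * h₄]

/-- The normal form in the coordinates `z = x₁ + i x₂`, `w = x₁ - i x₂`. -/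
def diagField (ω₁ ω₂ : ℝ) (h₁ h₂ h₃ h₄ : MvPowerSeries (Fin 2) ℂ) :
    Fin 4 → MvPowerSeries (Fin 4) ℂ :=
  fun k => inRadii (diagCoeff ω₁ ω₂ h₁ h₂ h₃ h₄ k) * X k

section Diag

variable {ω₁ ω₂ : ℝ} {h₁ h₂ h₃ h₄ : MvPowerSeries (Fin 2) ℂ}

lemma lieDeriv_diagField_radii (a : Fin 2) :
    lieDeriv (diagField ω₁ ω₂ h₁ h₂ h₃ h₄) (radii a) =
      2 * (inRadii (![h₁, h₃] a) * radii a) := by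
  have key : ∀ i j : Fin 4, lieDeriv (diagField ω₁ ω₂ h₁ h₂ h₃ h₄) (X i * X j) =
      (inRadii (diagCoeff ω₁ ω₂ h₁ h₂ h₃ h₄ i) + inRadii (diagCoeff ω₁ ω₂ h₁ h₂ h₃ h₄ j)) *
        (X i * X j) := by
    intro i j
    rw [Derivation.leibniz, lieDeriv_X, lieDeriv_X, smul_eq_mul, smul_eq_mul]
    simp only [diagField]
    ring
  have h2 : (2 : MvPowerSeries (Fin 4) ℂ) = inRadii (C 2) := by rw [inRadii_C, two_eq_C]
  obtain rfl | rfl : a = 0 ∨ a = 1 := by fin_cases a <;> simp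
  · rw [radii_zero, key, ← mul_assoc (2 : MvPowerSeries (Fin 4) ℂ), ← inRadii_add, h2, ← inRadii_mul,
      ← two_eq_C]
    congr 2
    simp only [diagCoeff, Matrix.cons_val]
    ring
  · rw [radii_one, key, ← mul_assoc (2 : MvPowerSeries (Fin 4) ℂ), ← inRadii_add, h2, ← inRadii_mul,
      ← two_eq_C]
    congr 2
    simp only [diagCoeff, Matrix.cons_val]
    ring

lemma lieDeriv_diagField_inRadii (g : MvPowerSeries (Fin 2) ℂ) :
    lieDeriv (diagField ω₁ ω₂ h₁ h₂ h₃ h₄) (inRadii g) = 2 * inRadii (logDeriv h₁ h₃ g) := by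
  rw [lieDeriv_inRadii, Fin.sum_univ_two, lieDeriv_diagField_radii, lieDeriv_diagField_radii,
    logDeriv_apply, inRadii_add, inRadii_mul, inRadii_mul, inRadii_mul, inRadii_mul, inRadii_X,
    inRadii_X]
  simp only [Matrix.cons_val_zero, Matrix.cons_val_one]
  ring

lemma isBalanced_of_sum_eq_zero (hω₂ : ω₂ ≠ 0) (hω : Irrational (ω₁ / ω₂))
    (h₁_zero : constantCoeff h₁ = 0) (h₂_zero : constantCoeff h₂ = 0)
    (h₃_zero : constantCoeff h₃ = 0) (h₄_zero : constantCoeff h₄ = 0) (e : Fin 4 →₀ ℕ)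
    (he : ∑ k, constantCoeff (diagCoeff ω₁ ω₂ h₁ h₂ h₃ h₄ k) * (e k : ℂ) = 0) : IsBalanced e := by
  simp only [diagCoeff, Fin.sum_univ_four, Matrix.cons_val, map_add, map_sub, map_neg, map_mul,
    constantCoeff_C, h₁_zero, h₂_zero, h₃_zero, h₄_zero] at he
  have h1 : Complex.I * ((ω₁ * ((e 0 : ℝ) - e 1) + ω₂ * ((e 2 : ℝ) - e 3) : ℝ) : ℂ) = 0 := by
    push_cast
    linear_combination he
  have h2 : ω₁ * ((e 0 : ℝ) - e 1) + ω₂ * ((e 2 : ℝ) - e 3) = 0 := by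
    have := (mul_eq_zero.1 h1).resolve_left Complex.I_ne_zero
    exact_mod_cast this
  have h3 : (e 0 : ℝ) - e 1 = 0 := by
    by_contra h
    refine hω ⟨((e 3 : ℚ) - e 2) / ((e 0 : ℚ) - e 1), ?_⟩
    push_cast
    rw [div_eq_div_iff h hω₂]
    linear_combination -h2
  have h4 : (e 2 : ℝ) - e 3 = 0 := by
    rw [h3, mul_zero, zero_add] at h2
    exact (mul_eq_zero.1 h2).resolve_left hω₂
  exact ⟨by exact_mod_cast sub_eq_zero.1 h3, by exact_mod_cast sub_eq_zero.1 h4⟩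

variable (hres : ∀ e : Fin 4 →₀ ℕ,
    ∑ k, constantCoeff (diagCoeff ω₁ ω₂ h₁ h₂ h₃ h₄ k) * (e k : ℂ) = 0 → IsBalanced e)

include hres

/-- Formal first integrals of the normal form are first integrals of the planar system. -/
lemma exists_inRadii_of_firstIntegral {G : MvPowerSeries (Fin 4) ℂ}
    (hG : lieDeriv (diagField ω₁ ω₂ h₁ h₂ h₃ h₄) G = 0) :
    ∃ g, G = inRadii g ∧ logDeriv h₁ h₃ g = 0 := by
  obtain ⟨g, hg⟩ := exists_eq_inRadii_of_lieDeriv (ι := Unit) hres (M := fun _ _ => 0)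
    (fun _ _ => map_zero _) (u := fun _ => G)
    (fun _ => by simpa [inRadii_zero] using! hG) ()
  refine ⟨g, hg, inRadii_injective ?_⟩
  rw [hg, lieDeriv_diagField_inRadii] at hG
  rw [inRadii_zero]
  refine (mul_eq_zero.1 hG).resolve_left ?_
  rw [two_eq_C]
  exact (map_ne_zero_iff C C_injective).2 two_ne_zero

/-- A formal vector field that commutes with the normal form induces a vector field
`r₁' = p r₁`, `r₂' = q r₂` that commutes with the planar system. -/
lemma exists_inRadii_of_commute {W : Fin 4 → MvPowerSeries (Fin 4) ℂ}
    (h₁_zero : constantCoeff h₁ = 0) (h₃_zero : constantCoeff h₃ = 0)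
    (hW : ∀ G, lieDeriv (diagField ω₁ ω₂ h₁ h₂ h₃ h₄) (lieDeriv W G) =
      lieDeriv W (lieDeriv (diagField ω₁ ω₂ h₁ h₂ h₃ h₄) G)) :
    ∃ p q, lieDeriv W (radii 0) = inRadii (X 0 * p) ∧ lieDeriv W (radii 1) = inRadii (X 1 * q) ∧
      logDeriv h₁ h₃ p = logDeriv p q h₁ ∧ logDeriv h₁ h₃ q = logDeriv p q h₃ := by
  have h2 : (2 : MvPowerSeries (Fin 4) ℂ) = inRadii (C 2) := by rw [inRadii_C, two_eq_C]
  have hXrad : ∀ a, lieDeriv (diagField ω₁ ω₂ h₁ h₂ h₃ h₄) (radii a) =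
      inRadii (C 2 * (![h₁, h₃] a * X a : MvPowerSeries (Fin 2) ℂ)) := by
    intro a
    rw [lieDeriv_diagField_radii, inRadii_mul, inRadii_mul, inRadii_X, ← h2]
  have hzero : ∀ a, constantCoeff (![h₁, h₃] a) = 0 := by
    intro a; fin_cases a <;> simp [h₁_zero, h₃_zero]
  have hU := exists_eq_inRadii_of_lieDeriv hres
    (M := fun a b => pderiv ℂ b (C 2 * (![h₁, h₃] a * X a : MvPowerSeries (Fin 2) ℂ)))
    (fun a b => by simp [Derivation.leibniz, hzero])
    (u := fun a => lieDeriv W (radii a))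
    (fun a => by
      change lieDeriv (diagField ω₁ ω₂ h₁ h₂ h₃ h₄) (lieDeriv W (radii a)) = _
      rw [hW, hXrad, lieDeriv_inRadii])
  obtain ⟨U₀, hU₀⟩ := hU 0
  obtain ⟨U₁, hU₁⟩ := hU 1
  -- `W (z w) = z W_w + w W_z` has no terms free of `z` and `w`
  have hdvd₀ : (X 0 : MvPowerSeries (Fin 2) ℂ) ∣ U₀ := by
    rw [X_dvd_iff]
    intro d hd
    obtain ⟨e0, e1, e2, e3⟩ := quadExp_apply d
    rw [← coeff_inRadii_quadExp, ← hU₀]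
    simp only [radii_zero, Derivation.leibniz, smul_eq_mul, map_add]
    rw [X_dvd_iff.1 (dvd_mul_right _ _) _ (e0.trans hd),
      X_dvd_iff.1 (dvd_mul_right _ _) _ (e1.trans hd), add_zero]
  have hdvd₁ : (X 1 : MvPowerSeries (Fin 2) ℂ) ∣ U₁ := by
    rw [X_dvd_iff]
    intro d hd
    obtain ⟨e0, e1, e2, e3⟩ := quadExp_apply d
    rw [← coeff_inRadii_quadExp, ← hU₁]
    simp only [radii_one, Derivation.leibniz, smul_eq_mul, map_add]
    rw [X_dvd_iff.1 (dvd_mul_right _ _) _ (e2.trans hd),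
      X_dvd_iff.1 (dvd_mul_right _ _) _ (e3.trans hd), add_zero]
  obtain ⟨p, rfl⟩ := hdvd₀
  obtain ⟨q, rfl⟩ := hdvd₁
  have hWg : ∀ g, lieDeriv W (inRadii g) = inRadii (logDeriv p q g) := by
    intro g
    rw [lieDeriv_inRadii, Fin.sum_univ_two, hU₀, hU₁, logDeriv_apply, ← inRadii_mul, ← inRadii_mul,
      ← inRadii_add]
    congr 1; ring
  have hcomm : ∀ g, logDeriv h₁ h₃ (logDeriv p q g) = logDeriv p q (logDeriv h₁ h₃ g) := by
    intro g
    have h := hW (inRadii g)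
    rw [hWg, lieDeriv_diagField_inRadii, lieDeriv_diagField_inRadii, h2, ← inRadii_mul,
      ← inRadii_mul, hWg] at h
    have h' := inRadii_injective h
    rw [Derivation.leibniz] at h'
    have h3 : logDeriv p q (C 2) = 0 := by rw [logDeriv_apply]; simp
    rw [h3, smul_zero, add_zero, smul_eq_mul] at h'
    exact mul_left_cancel₀ ((map_ne_zero_iff C C_injective).2 two_ne_zero) h'
  have hX0 : ∀ p q : MvPowerSeries (Fin 2) ℂ, logDeriv p q (X 0) = p * X 0 := by
    intro p q; rw [logDeriv_apply]; simp [pderiv_X_of_ne]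
  have hX1 : ∀ p q : MvPowerSeries (Fin 2) ℂ, logDeriv p q (X 1) = q * X 1 := by
    intro p q; rw [logDeriv_apply]; simp [pderiv_X_of_ne]
  refine ⟨p, q, hU₀, hU₁, ?_, ?_⟩
  · have h := hcomm (X 0)
    rw [hX0, hX0, Derivation.leibniz, Derivation.leibniz, hX0, hX0] at h
    simp only [smul_eq_mul] at h
    refine mul_left_cancel₀ (mvX_ne_zero (0 : Fin 2)) (b := logDeriv h₁ h₃ p) ?_
    linear_combination h
  · have h := hcomm (X 1)
    rw [hX1, hX1, Derivation.leibniz, Derivation.leibniz, hX1, hX1] at h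
    simp only [smul_eq_mul] at h
    refine mul_left_cancel₀ (mvX_ne_zero (1 : Fin 2)) (b := logDeriv h₁ h₃ q) ?_
    linear_combination h

end Diag

end DoubleHopf

end

noncomputable section

/-! ### Integrability of polynomial vector fields -/

namespace DoubleHopf

section PolynomialFields

open MvPolynomial

lemma hasFDerivAt_eval {n : ℕ} (p : MvPolynomial (Fin n) ℂ) (x : Fin n → ℂ) :
    HasFDerivAt (fun x => eval x p)
      (∑ i, eval x (pderiv i p) • ContinuousLinearMap.proj (R := ℂ) (φ := fun _ : Fin n => ℂ) i)
      x := by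
  classical
  induction p using MvPolynomial.induction_on with
  | C r =>
    simp only [eval_C]
    refine (hasFDerivAt_const r x).congr_fderiv (ContinuousLinearMap.ext fun v => ?_)
    simp
  | add p q hp hq =>
    simp only [map_add]
    refine (hp.add hq).congr_fderiv (ContinuousLinearMap.ext fun v => ?_)
    simp [add_mul, Finset.sum_add_distrib]
  | mul_X p j hp =>
    simp only [map_mul, eval_X]
    refine (hp.mul (ContinuousLinearMap.proj (R := ℂ) (φ := fun _ : Fin n => ℂ)
      j).hasFDerivAt).congr_fderiv (ContinuousLinearMap.ext fun v => ?_)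
    simp only [Derivation.leibniz, smul_eq_mul, map_add, map_mul, eval_X, pderiv_X]
    simp [Pi.single_apply, apply_ite (eval x), Finset.mul_sum, mul_assoc, add_mul,
      Finset.sum_add_distrib]

lemma fderiv_eval {n : ℕ} (p : MvPolynomial (Fin n) ℂ) (x v : Fin n → ℂ) :
    fderiv ℂ (fun x => eval x p) x v = ∑ i, v i * eval x (pderiv i p) := by
  rw [(hasFDerivAt_eval p x).fderiv]
  simp [mul_comm]

/-- A nonzero complex polynomial vanishes only on a null set. -/
lemma ae_eval_ne_zero {n : ℕ} {p : MvPolynomial (Fin n) ℂ} (hp : p ≠ 0) :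
    ∀ᵐ x : Fin n → ℂ, eval x p ≠ 0 := by
  induction n with
  | zero =>
    refine Eventually.of_forall fun x => ?_
    rw [eq_C_of_isEmpty p] at hp ⊢
    rw [eval_C]
    exact fun h => hp (by rw [h, C_0])
  | succ n ih =>
    set P := finSuccEquiv ℂ n p with hP
    have hP0 : P ≠ 0 := (map_ne_zero_iff _ (finSuccEquiv ℂ n).injective).2 hp
    have hlead := ih (Polynomial.leadingCoeff_ne_zero.2 hP0)
    have hmeas : MeasurableSet {x : Fin (n + 1) → ℂ | eval x p ≠ 0} :=
      ((MvPolynomial.continuous_eval p).measurable (measurableSet_singleton 0)).compl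
    have hpres := volume_preserving_piFinSuccAbove (fun _ : Fin (n + 1) => ℂ) 0
    have hpres' := hpres.symm
    rw [← hpres'.map_eq]
    rw [ae_map_iff hpres'.measurable.aemeasurable hmeas]
    have hswap := Measure.measurePreserving_swap (μ := (volume : Measure (Fin n → ℂ)))
      (ν := (volume : Measure ℂ))
    have hmeas' : MeasurableSet {y : ℂ × (Fin n → ℂ) |
        eval ((MeasurableEquiv.piFinSuccAbove (fun _ : Fin (n + 1) => ℂ) 0).symm y) p ≠ 0} :=
      hpres'.measurable hmeas
    rw [Measure.volume_eq_prod, ← hswap.map_eq, ae_map_iff hswap.measurable.aemeasurable hmeas']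
    refine (Measure.ae_prod_iff_ae_ae (hswap.measurable hmeas')).2 ?_
    · filter_upwards [hlead] with s hs
      have hroot : (P.map (eval s)) ≠ 0 := by
        intro h
        have := congrArg (fun Q => Polynomial.coeff Q P.natDegree) h
        simp only [Polynomial.coeff_map, Polynomial.coeff_zero] at this
        exact hs this
      have hfin : ((P.map (eval s)).rootSet ℂ).Finite := Polynomial.rootSet_finite _ _
      have hnull : ∀ᵐ y : ℂ, y ∉ (P.map (eval s)).rootSet ℂ :=
        measure_eq_zero_iff_ae_notMem.1 (hfin.measure_zero _)
      filter_upwards [hnull] with y hy h0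
      refine hy ?_
      rw [Polynomial.mem_rootSet]
      refine ⟨hroot, ?_⟩
      have h1 := eval_eq_eval_mv_eval' s y p
      have h2 : (MeasurableEquiv.piFinSuccAbove (fun _ : Fin (n + 1) => ℂ) 0).symm (y, s) =
          Fin.cons y s := by
        ext i
        refine Fin.cases ?_ (fun i => ?_) i <;> simp [MeasurableEquiv.piFinSuccAbove]
      simp only [Prod.swap_prod_mk] at h0
      rw [h2, h1] at h0
      simpa [Polynomial.aeval_def] using h0

lemma eq_C_of_pderiv_eq_zero {σ : Type*} {p : MvPolynomial σ ℂ} (h : ∀ i, pderiv i p = 0) :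
    p = C (coeff 0 p) := by
  refine MvPolynomial.coe_injective σ ℂ ?_
  refine MvPowerSeries.pderiv.ext (fun i => ?_) ?_
  · rw [MvPowerSeries.pderiv_coe, MvPowerSeries.pderiv_coe, h, pderiv_C]
  · rw [← MvPowerSeries.coeff_zero_eq_constantCoeff_apply,
      ← MvPowerSeries.coeff_zero_eq_constantCoeff_apply, coeff_coe, coeff_coe]
    simp

/-- The vector field with polynomial components `R`. -/
def polyField {n : ℕ} (R : Fin n → MvPolynomial (Fin n) ℂ) : (Fin n → ℂ) → Fin n → ℂ :=
  fun x i => eval x (R i)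

lemma polyField_analyticOnNhd {n : ℕ} (R : Fin n → MvPolynomial (Fin n) ℂ) :
    AnalyticOnNhd ℂ (polyField R) Set.univ := by
  refine AnalyticOnNhd.pi fun i => ?_
  exact AnalyticOnNhd.eval_mvPolynomial (R i)

lemma fderiv_polyField {n : ℕ} (R : Fin n → MvPolynomial (Fin n) ℂ) (x v : Fin n → ℂ) (k : Fin n) :
    fderiv ℂ (polyField R) x v k = ∑ i, v i * eval x (pderiv i (R k)) := by
  have h : HasFDerivAt (polyField R) (ContinuousLinearMap.pi fun k => fderiv ℂ
      (fun x => eval x (R k)) x) x :=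
    hasFDerivAt_pi.2 fun k => (hasFDerivAt_eval (R k) x).differentiableAt.hasFDerivAt
  rw [h.fderiv, ContinuousLinearMap.pi_apply, fderiv_eval]

/-- A nonzero planar polynomial vector field with a nonconstant polynomial first integral is
integrable. -/
lemma integrable_of_firstIntegral {R : Fin 2 → MvPolynomial (Fin 2) ℂ} (hR : ∃ i, R i ≠ 0)
    {F : MvPolynomial (Fin 2) ℂ} (hF : ∃ i, pderiv i F ≠ 0) (hRF : ∑ i, R i * pderiv i F = 0)
    (x₀ : Fin 2 → ℂ) : AnalyticallyIntegrableNear (polyField R) x₀ := by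
  refine ⟨1, 1, one_pos, rfl, Set.univ, fun _ => polyField R, fun _ x => eval x F, isOpen_univ,
    Set.mem_univ _, fun _ _ => rfl, fun _ => polyField_analyticOnNhd R,
    fun _ => AnalyticOnNhd.eval_mvPolynomial F, ?_, ?_, ?_, ?_⟩
  · obtain ⟨i, hi⟩ := hR
    rw [Measure.restrict_univ]
    filter_upwards [ae_eval_ne_zero hi] with x hx
    rw [linearIndependent_unique_iff]
    exact fun h => hx (congrFun h i)
  · intro _ _ x _
    simp [VectorField.lieBracket]
  · obtain ⟨i, hi⟩ := hF
    rw [Measure.restrict_univ]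
    filter_upwards [ae_eval_ne_zero hi] with x hx
    rw [linearIndependent_unique_iff]
    intro h
    have h1 := congrArg (fun L : (Fin 2 → ℂ) →L[ℂ] ℂ => L (Pi.single i 1)) h
    simp only [fderiv_eval] at h1
    rw [Finset.sum_eq_single i] at h1
    · simp at h1; exact hx h1
    · intro j _ hj; simp [hj]
    · simp
  · intro _ _ x _
    rw [fderiv_eval]
    have := congrArg (eval x) hRF
    simpa [polyField] using! this

/-- A planar polynomial vector field that commutes with a generically independent one is
integrable. -/
lemma integrable_of_commute {R W : Fin 2 → MvPolynomial (Fin 2) ℂ}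
    (hRW : R 0 * W 1 - R 1 * W 0 ≠ 0)
    (hcomm : ∀ k, ∑ i, R i * pderiv i (W k) = ∑ i, W i * pderiv i (R k))
    (x₀ : Fin 2 → ℂ) : AnalyticallyIntegrableNear (polyField R) x₀ := by
  have hbr : ∀ x, VectorField.lieBracket ℂ (polyField R) (polyField W) x = 0 := by
    intro x
    funext k
    have := congrArg (eval x) (hcomm k)
    simp only [map_sum, map_mul] at this
    simp only [VectorField.lieBracket, Pi.sub_apply, fderiv_polyField, Pi.zero_apply]
    exact sub_eq_zero.2 this
  refine ⟨2, 0, two_pos, rfl, Set.univ, ![polyField R, polyField W], Fin.elim0, isOpen_univ,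
    Set.mem_univ _, fun _ _ => rfl, ?_, fun l => l.elim0, ?_, ?_,
    Eventually.of_forall fun x => linearIndependent_empty_type, fun l => l.elim0⟩
  · intro j
    fin_cases j
    exacts [polyField_analyticOnNhd R, polyField_analyticOnNhd W]
  · rw [Measure.restrict_univ]
    filter_upwards [ae_eval_ne_zero hRW] with x hx
    have h1 : (fun j => (![polyField R, polyField W] : Fin 2 → _) j x) =
        ![polyField R x, polyField W x] := by
      funext j; fin_cases j <;> rfl
    rw [h1, LinearIndependent.pair_iff]
    intro s t hst
    have e0 := congrFun hst 0
    have e1 := congrFun hst 1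
    simp only [Pi.add_apply, Pi.smul_apply, smul_eq_mul, polyField, Pi.zero_apply] at e0 e1
    simp only [map_sub, map_mul] at hx
    constructor
    · refine (mul_eq_zero.1 (?_ : s * (eval x (R 0) * eval x (W 1) -
        eval x (R 1) * eval x (W 0)) = 0)).resolve_right hx
      linear_combination eval x (W 1) * e0 - eval x (W 0) * e1
    · refine (mul_eq_zero.1 (?_ : t * (eval x (R 0) * eval x (W 1) -
        eval x (R 1) * eval x (W 0)) = 0)).resolve_right hx
      linear_combination eval x (R 0) * e1 - eval x (R 1) * e0
  · intro i j x _
    have hbr' : VectorField.lieBracket ℂ (polyField W) (polyField R) x = 0 := by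
      rw [VectorField.lieBracket_swap, hbr, neg_zero]
    fin_cases i <;> fin_cases j
    · simp [VectorField.lieBracket]
    · exact hbr x
    · exact hbr'
    · simp [VectorField.lieBracket]

end PolynomialFields

end DoubleHopf

end

noncomputable section

/-! ### Integrability of the truncated planar system -/

namespace DoubleHopf

section Truncated

open MvPolynomial

/-- The derivation `p y₁ ∂₁ + q y₂ ∂₂` on polynomials in `y₁ = r₁ ^ 2` and `y₂ = r₂ ^ 2`. -/
def logDerivPoly (p q : MvPolynomial (Fin 2) ℂ) :
    Derivation ℂ (MvPolynomial (Fin 2) ℂ) (MvPolynomial (Fin 2) ℂ) :=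
  (p * X 0) • pderiv 0 + (q * X 1) • pderiv 1

lemma logDerivPoly_apply (p q g : MvPolynomial (Fin 2) ℂ) :
    logDerivPoly p q g = p * (X 0 * pderiv 0 g) + q * (X 1 * pderiv 1 g) := by
  simp [logDerivPoly, mul_assoc]

lemma pderiv_expand_two {σ : Type*} (i : σ) (p : MvPolynomial σ ℂ) :
    pderiv i (expand 2 p) = 2 * X i * expand 2 (pderiv i p) := by
  classical
  induction p using MvPolynomial.induction_on with
  | C r => simp
  | add p q hp hq => simp [hp, hq, mul_add]
  | mul_X p j hp =>
    simp only [map_mul, expand_X, Derivation.leibniz, hp, smul_eq_mul, map_add, pderiv_X,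
      Derivation.leibniz_pow]
    by_cases h : i = j
    · subst h; simp; ring
    · simp [Pi.single_eq_of_ne' h]; ring

/-- The vector field `r₁' = p(r₁², r₂²) r₁`, `r₂' = q(r₁², r₂²) r₂`. -/
def radialField (p q : MvPolynomial (Fin 2) ℂ) : Fin 2 → MvPolynomial (Fin 2) ℂ :=
  ![expand 2 p * X 0, expand 2 q * X 1]

lemma sum_radialField_mul_pderiv_expand (p q g : MvPolynomial (Fin 2) ℂ) :
    ∑ i, radialField p q i * pderiv i (expand 2 g) = 2 * expand 2 (logDerivPoly p q g) := by
  simp only [radialField, Fin.sum_univ_two, Matrix.cons_val_zero, Matrix.cons_val_one,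
    pderiv_expand_two, logDerivPoly_apply, map_add, map_mul, expand_X]
  ring

variable {l₁ l₂ : MvPolynomial (Fin 2) ℂ}

lemma radialField_ne_zero (h : l₁ ≠ 0 ∨ l₂ ≠ 0) : ∃ i, radialField l₁ l₂ i ≠ 0 := by
  have hX : ∀ i : Fin 2, (X i : MvPolynomial (Fin 2) ℂ) ≠ 0 := fun i => X_ne_zero i
  have he : ∀ p : MvPolynomial (Fin 2) ℂ, p ≠ 0 → expand 2 p ≠ 0 := fun p hp h =>
    hp ((expand_eq_zero two_pos).1 h)
  rcases h with h | h
  · exact ⟨0, mul_ne_zero (he _ h) (hX 0)⟩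
  · exact ⟨1, mul_ne_zero (he _ h) (hX 1)⟩

lemma integrable_of_logDerivPoly_eq_zero (hl : l₁ ≠ 0 ∨ l₂ ≠ 0) {φ : MvPolynomial (Fin 2) ℂ}
    (hφ : ∃ i, pderiv i φ ≠ 0) (h : logDerivPoly l₁ l₂ φ = 0) :
    AnalyticallyIntegrableNear (polyField (radialField l₁ l₂)) 0 := by
  refine integrable_of_firstIntegral (F := expand 2 φ) (radialField_ne_zero hl) ?_ ?_ 0
  · obtain ⟨i, hi⟩ := hφ
    refine ⟨i, ?_⟩
    rw [pderiv_expand_two]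
    refine mul_ne_zero (mul_ne_zero two_ne_zero (X_ne_zero i)) fun h => hi ?_
    exact (expand_eq_zero two_pos).1 h
  · rw [sum_radialField_mul_pderiv_expand, h, map_zero, mul_zero]

lemma integrable_of_logDerivPoly_commute {p q : MvPolynomial (Fin 2) ℂ}
    (hp : logDerivPoly l₁ l₂ p = logDerivPoly p q l₁)
    (hq : logDerivPoly l₁ l₂ q = logDerivPoly p q l₂) (hpq : p * l₂ ≠ q * l₁) :
    AnalyticallyIntegrableNear (polyField (radialField l₁ l₂)) 0 := by
  refine integrable_of_commute (W := radialField p q) ?_ ?_ 0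
  · have h : radialField l₁ l₂ 0 * radialField p q 1 - radialField l₁ l₂ 1 * radialField p q 0 =
        X 0 * X 1 * expand 2 (q * l₁ - p * l₂) := by
      simp only [radialField, Matrix.cons_val_zero, Matrix.cons_val_one, map_sub, map_mul]
      ring
    rw [h]
    refine mul_ne_zero (mul_ne_zero (X_ne_zero _) (X_ne_zero _)) fun h => hpq ?_
    exact (sub_eq_zero.1 ((expand_eq_zero two_pos).1 h)).symm
  · have key : ∀ a b g : MvPolynomial (Fin 2) ℂ, ∀ k, ∑ i, radialField a b i *
        pderiv i (expand 2 g * X k) =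
          2 * expand 2 (logDerivPoly a b g) * X k + expand 2 g * radialField a b k := by
      intro a b g k
      rw [← sum_radialField_mul_pderiv_expand, Fin.sum_univ_two, Fin.sum_univ_two]
      fin_cases k <;> simp <;> ring
    intro k
    fin_cases k
    · refine (key l₁ l₂ p 0).trans (.trans ?_ (key p q l₁ 0).symm)
      rw [hp]
      simp only [radialField, Matrix.cons_val_zero]; ring
    · refine (key l₁ l₂ q 1).trans (.trans ?_ (key p q l₂ 1).symm)
      rw [hq]
      simp only [radialField, Matrix.cons_val_one, Matrix.cons_val_zero]; ring

/-- The system `r₁' = (a r₁² + b r₂²) r₁`, `r₂' = (a r₁² + b r₂²) r₂` commutes with the rotation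
field that preserves `a r₁² + b r₂²`. -/
lemma integrable_of_eq {a b : ℂ} (h : C a * X 0 + C b * X 1 ≠ (0 : MvPolynomial (Fin 2) ℂ)) :
    AnalyticallyIntegrableNear
      (polyField (radialField (C a * X 0 + C b * X 1) (C a * X 0 + C b * X 1))) 0 := by
  refine integrable_of_commute (W := ![C b * X 1, -(C a * X 0)]) ?_ ?_ 0
  · have h1 : expand 2 (C a * X 0 + C b * X 1 : MvPolynomial (Fin 2) ℂ) ≠ 0 :=
      fun h' => h ((expand_eq_zero two_pos).1 h')
    have h2 : ∀ L : MvPolynomial (Fin 2) ℂ, L = C a * X 0 ^ 2 + C b * X 1 ^ 2 →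
        L * X 0 * -(C a * X 0) - L * X 1 * (C b * X 1) = -(L * L) := by
      rintro L rfl; ring
    simp only [radialField, Matrix.cons_val_zero, Matrix.cons_val_one]
    rw [h2 _ (by simp)]
    exact neg_ne_zero.2 (mul_ne_zero h1 h1)
  · intro k
    fin_cases k <;> simp [radialField, Fin.sum_univ_two] <;> ring

lemma prime_linear {a b : ℂ} (h : C a * X 0 + C b * X 1 ≠ (0 : MvPolynomial (Fin 2) ℂ)) :
    Prime (C a * X 0 + C b * X 1 : MvPolynomial (Fin 2) ℂ) := by
  have h1 : (C a * X 0 + C b * X 1 : MvPolynomial (Fin 2) ℂ) =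
      sumSMulX (Finsupp.single 0 a + Finsupp.single 1 b) := by
    simp [sumSMulX, smul_eq_C_mul]
  have h0 : (Finsupp.single 0 a + Finsupp.single 1 b : Fin 2 →₀ ℂ) ≠ 0 := by
    intro h0
    rw [h1, h0, map_zero] at h
    exact h rfl
  rw [h1]
  refine (irreducible_sumSMulX _ (Finsupp.support_nonempty_iff.2 h0) fun r hr => ?_).prime
  rw [isUnit_iff_ne_zero]
  rintro rfl
  exact h0 (Finsupp.ext fun i => zero_dvd_iff.1 (hr i))

/-- If a commuting field `(p, q)` is a polynomial multiple of the truncated system, the multiplier is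
a first integral of the truncated system; it proves integrability unless it is constant. -/
lemma integrable_or_of_eq_mul (hl : l₁ ≠ 0 ∨ l₂ ≠ 0) {p q φ : MvPolynomial (Fin 2) ℂ}
    (hp : logDerivPoly l₁ l₂ p = logDerivPoly p q l₁)
    (hq : logDerivPoly l₁ l₂ q = logDerivPoly p q l₂) (hpφ : p = φ * l₁) (hqφ : q = φ * l₂) :
    AnalyticallyIntegrableNear (polyField (radialField l₁ l₂)) 0 ∨
      ∃ c, p = C c * l₁ ∧ q = C c * l₂ := by
  have hφ : logDerivPoly l₁ l₂ φ = 0 := by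
    have key : ∀ l, l ≠ 0 → logDerivPoly l₁ l₂ (φ * l) = logDerivPoly (φ * l₁) (φ * l₂) l →
        logDerivPoly l₁ l₂ φ = 0 := by
      intro l hl h
      rw [Derivation.leibniz, smul_eq_mul, smul_eq_mul, logDerivPoly_apply (φ * l₁),
        logDerivPoly_apply _ _ l] at h
      refine (mul_eq_zero.1 (?_ : l * logDerivPoly l₁ l₂ φ = 0)).resolve_left hl
      linear_combination h
    rw [hpφ, hqφ] at hp hq
    rcases hl with h | h
    · exact key l₁ h hp
    · exact key l₂ h hq
  by_cases hc : ∃ i, pderiv i φ ≠ 0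
  · exact Or.inl (integrable_of_logDerivPoly_eq_zero hl hc hφ)
  · push Not at hc
    right
    refine ⟨coeff 0 φ, ?_, ?_⟩
    · rw [← eq_C_of_pderiv_eq_zero hc]; exact hpφ
    · rw [← eq_C_of_pderiv_eq_zero hc]; exact hqφ

/-- A polynomial field `(p, q)` commuting with the truncated system either shows that the latter is
integrable or is a constant multiple of it. -/
theorem integrable_or_eq_smul {a₁ a₂ a₃ a₄ : ℂ} (hl₁ : l₁ = C a₁ * X 0 + C a₂ * X 1)
    (hl₂ : l₂ = C a₃ * X 0 + C a₄ * X 1) (hl : l₁ ≠ 0 ∨ l₂ ≠ 0) {p q : MvPolynomial (Fin 2) ℂ}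
    (hp : logDerivPoly l₁ l₂ p = logDerivPoly p q l₁)
    (hq : logDerivPoly l₁ l₂ q = logDerivPoly p q l₂) :
    AnalyticallyIntegrableNear (polyField (radialField l₁ l₂)) 0 ∨
      ∃ c, p = C c * l₁ ∧ q = C c * l₂ := by
  by_cases hpq : p * l₂ = q * l₁
  swap
  · exact Or.inl (integrable_of_logDerivPoly_commute hp hq hpq)
  by_cases h1 : l₁ = 0
  · refine Or.inl (integrable_of_logDerivPoly_eq_zero hl (φ := X 0) ⟨0, by simp⟩ ?_)
    rw [logDerivPoly_apply, h1]; simp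
  by_cases h2 : l₂ = 0
  · refine Or.inl (integrable_of_logDerivPoly_eq_zero hl (φ := X 1) ⟨1, by simp⟩ ?_)
    rw [logDerivPoly_apply, h2]; simp
  have hprime : Prime l₁ := by rw [hl₁] at h1 ⊢; exact prime_linear h1
  -- if `l₁` divides `p`, the quotient is a common multiplier
  have hdvd : l₁ ∣ p → AnalyticallyIntegrableNear (polyField (radialField l₁ l₂)) 0 ∨
      ∃ c, p = C c * l₁ ∧ q = C c * l₂ := by
    rintro ⟨φ, hφ⟩
    refine integrable_or_of_eq_mul hl hp hq (φ := φ) (by rw [hφ, mul_comm]) ?_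
    refine mul_right_cancel₀ h1 ?_
    rw [← hpq, hφ]; ring
  rcases hprime.dvd_or_dvd (Dvd.intro_left q hpq.symm) with h | ⟨u, hu⟩
  · exact hdvd h
  -- `l₂` is a multiple of `l₁`
  have hdet : a₃ * a₂ = a₄ * a₁ := by
    have := congrArg (eval ![a₂, -a₁]) hu
    rw [hl₁, hl₂] at this
    simp only [map_add, map_mul, eval_C, eval_X, Matrix.cons_val_zero, Matrix.cons_val_one] at this
    linear_combination this
  have ha : a₁ ≠ 0 ∨ a₂ ≠ 0 := by
    by_contra! h
    rw [hl₁, h.1, h.2] at h1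
    simp at h1
  obtain ⟨c, hc3, hc4⟩ : ∃ c, a₃ = c * a₁ ∧ a₄ = c * a₂ := by
    rcases ha with h | h
    · refine ⟨a₃ / a₁, by field_simp, ?_⟩
      field_simp; exact hdet.symm
    · refine ⟨a₄ / a₂, ?_, by field_simp⟩
      field_simp; exact hdet
  have hlc : l₂ = C c * l₁ := by
    rw [hl₁, hl₂, hc3, hc4, C_mul, C_mul]; ring
  have hqc : q = C c * p := by
    refine mul_right_cancel₀ h1 ?_
    rw [← hpq, hlc]; ring
  by_cases ha2 : a₂ = 0
  · -- `r₂ ∂₂` commutes with the system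
    refine Or.inl (integrable_of_logDerivPoly_commute (p := 0) (q := 1) ?_ ?_ ?_)
    · rw [logDerivPoly_apply, hl₁, ha2]; simp [logDerivPoly_apply]
    · rw [logDerivPoly_apply, hl₂, hc4, ha2]; simp [logDerivPoly_apply]
    · rw [zero_mul, one_mul]; exact Ne.symm h1
  by_cases ha1 : a₁ = 0
  · -- `r₁ ∂₁` commutes with the system
    refine Or.inl (integrable_of_logDerivPoly_commute (p := 1) (q := 0) ?_ ?_ ?_)
    · rw [logDerivPoly_apply, hl₁, ha1]; simp [logDerivPoly_apply]
    · rw [logDerivPoly_apply, hl₂, hc3, ha1]; simp [logDerivPoly_apply]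
    · rw [zero_mul, one_mul]; exact h2
  by_cases hc1 : c = 1
  · left
    rw [hc1, C_1, one_mul] at hlc
    rw [hlc, hl₁]
    rw [hl₁] at h1
    exact integrable_of_eq h1
  · -- `l₁` divides `p * (y₁ ∂₁ + c y₂ ∂₂) l₁`, and it does not divide the second factor
    have h3 : p * (C a₁ * X 0 + C (c * a₂) * X 1) =
        l₁ * (X 0 * pderiv 0 p + C c * (X 1 * pderiv 1 p)) := by
      have e1 : pderiv 0 l₁ = C a₁ := by rw [hl₁]; simp
      have e2 : pderiv 1 l₁ = C a₂ := by rw [hl₁]; simp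
      rw [logDerivPoly_apply, logDerivPoly_apply, hlc, hqc, e1, e2] at hp
      rw [C_mul]
      linear_combination -hp
    rcases hprime.dvd_or_dvd (Dvd.intro _ h3.symm) with h | ⟨v, hv⟩
    · exact hdvd h
    · exfalso
      have := congrArg (eval ![a₂, -a₁]) hv
      rw [hl₁] at this
      simp only [map_add, map_mul, eval_C, eval_X, Matrix.cons_val_zero, Matrix.cons_val_one] at this
      have h4 : a₁ * a₂ * (1 - c) = 0 := by linear_combination this
      exact mul_ne_zero (mul_ne_zero ha1 ha2) (sub_ne_zero.2 (Ne.symm hc1)) h4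

lemma truncatedPlanar_eq (α₁ α₂ α₃ α₄ : ℝ) : truncatedPlanar α₁ α₂ α₃ α₄ =
    polyField (radialField (C (α₁ : ℂ) * X 0 + C (α₂ : ℂ) * X 1)
      (C (α₃ : ℂ) * X 0 + C (α₄ : ℂ) * X 1)) := by
  funext r i
  fin_cases i <;> simp [truncatedPlanar, polyField, radialField]

end Truncated

/-! ### Lowest-order parts of power series -/

section HomPart

open MvPowerSeries

variable {σ : Type*} [Finite σ] {K : Type*} [Field K]

/-- The homogeneous component of degree `n` of a power series, as a polynomial. -/
def homPart (n : ℕ) (f : MvPowerSeries σ K) : MvPolynomial σ K :=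
  truncTotal (n + 1) (homogeneousComponent n f)

lemma coe_homPart (n : ℕ) (f : MvPowerSeries σ K) :
    (homPart n f : MvPowerSeries σ K) = homogeneousComponent n f := by
  ext d
  rw [MvPolynomial.coeff_coe, homPart, coeff_truncTotal_eq_ite, coeff_homogeneousComponent]
  split_ifs with h1 h2 <;> first | rfl | omega

lemma coeff_homPart (n : ℕ) (f : MvPowerSeries σ K) (d : σ →₀ ℕ) :
    MvPolynomial.coeff d (homPart n f) = if d.degree = n then coeff d f else 0 := by
  rw [← MvPolynomial.coeff_coe, coe_homPart, coeff_homogeneousComponent]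

lemma homPart_add (n : ℕ) (f g : MvPowerSeries σ K) :
    homPart n (f + g) = homPart n f + homPart n g := by
  simp only [homPart, map_add]

lemma homPart_sub (n : ℕ) (f g : MvPowerSeries σ K) :
    homPart n (f - g) = homPart n f - homPart n g := by
  simp only [homPart, map_sub]

lemma homPart_C_mul (n : ℕ) (c : K) (f : MvPowerSeries σ K) :
    homPart n (C c * f) = MvPolynomial.C c * homPart n f := by
  simp only [homPart, ← smul_eq_C_mul, map_smul, MvPolynomial.smul_eq_C_mul]

lemma homPart_mul {m n : ℕ} {f g : MvPowerSeries σ K} (hf : m ≤ f.order) (hg : n ≤ g.order) :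
    homPart (m + n) (f * g) = homPart m f * homPart n g := by
  refine MvPolynomial.coe_injective σ K ?_
  rw [MvPolynomial.coe_mul, coe_homPart, coe_homPart, coe_homPart,
    homogeneousComponent_mul_of_le_order hf hg]

omit [Finite σ] in
lemma le_order_X_mul_pderiv {n : ℕ} {f : MvPowerSeries σ K} (hf : (n : ℕ∞) ≤ f.order) (i : σ) :
    (n : ℕ∞) ≤ (X i * pderiv K i f).order := by
  refine nat_le_order fun d hd => ?_
  rw [coeff_X_mul_pderiv, coeff_of_lt_order, mul_zero]
  exact lt_of_lt_of_le (by exact_mod_cast hd) hf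

lemma homPart_X_mul_pderiv (n : ℕ) (f : MvPowerSeries σ K) (i : σ) :
    homPart n (X i * pderiv K i f) = MvPolynomial.X i * MvPolynomial.pderiv i (homPart n f) := by
  refine MvPolynomial.coe_injective σ K ?_
  rw [MvPolynomial.coe_mul, MvPolynomial.coe_X, ← pderiv_coe, coe_homPart, coe_homPart]
  ext d
  rw [coeff_homogeneousComponent, coeff_X_mul_pderiv, coeff_X_mul_pderiv,
    coeff_homogeneousComponent]
  split_ifs <;> simp

lemma homPart_logDeriv {m n : ℕ} {p q g : MvPowerSeries (Fin 2) ℂ} (hp : m ≤ p.order)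
    (hq : m ≤ q.order) (hg : n ≤ g.order) :
    homPart (m + n) (logDeriv p q g) =
      logDerivPoly (homPart m p) (homPart m q) (homPart n g) := by
  rw [logDeriv_apply, logDerivPoly_apply, homPart_add, homPart_mul hp (le_order_X_mul_pderiv hg 0),
    homPart_mul hq (le_order_X_mul_pderiv hg 1), homPart_X_mul_pderiv, homPart_X_mul_pderiv]

lemma homPart_zero (n : ℕ) : homPart n (0 : MvPowerSeries σ K) = 0 := by
  simp only [homPart, map_zero]

/-- Two power series, not both zero, have a common lowest degree. -/
lemma exists_homPart_ne_zero {p q : MvPowerSeries σ K} (h : p ≠ 0 ∨ q ≠ 0) :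
    ∃ m : ℕ, m ≤ p.order ∧ m ≤ q.order ∧ (homPart m p ≠ 0 ∨ homPart m q ≠ 0) := by
  classical
  have hex : ∃ m : ℕ, homPart m p ≠ 0 ∨ homPart m q ≠ 0 := by
    by_contra! hc
    have key : ∀ f : MvPowerSeries σ K, (∀ m, homPart m f = 0) → f = 0 := by
      intro f hf
      ext d
      have := congrArg (MvPolynomial.coeff d) (hf d.degree)
      simpa [coeff_homPart] using this
    rcases h with h | h
    · exact h (key p fun m => (hc m).1)
    · exact h (key q fun m => (hc m).2)
  have hmin : ∀ d : σ →₀ ℕ, d.degree < Nat.find hex → coeff d p = 0 ∧ coeff d q = 0 := by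
    intro d hd
    have h1 := Nat.find_min hex hd
    push Not at h1
    have h2 := congrArg (MvPolynomial.coeff d) h1.1
    have h3 := congrArg (MvPolynomial.coeff d) h1.2
    simp only [coeff_homPart, if_true, MvPolynomial.coeff_zero] at h2 h3
    exact ⟨h2, h3⟩
  exact ⟨Nat.find hex, nat_le_order fun d hd => (hmin d hd).1,
    nat_le_order fun d hd => (hmin d hd).2, Nat.find_spec hex⟩

end HomPart

section Reduction

open MvPowerSeries

variable {P Q : MvPowerSeries (Fin 2) ℂ}

lemma homPart_one_eq {P : MvPowerSeries (Fin 2) ℂ} :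
    homPart 1 P = MvPolynomial.C (coeff (Finsupp.single 0 1) P) * MvPolynomial.X 0 +
      MvPolynomial.C (coeff (Finsupp.single 1 1) P) * MvPolynomial.X 1 := by
  classical
  ext d
  rw [coeff_homPart, MvPolynomial.coeff_add, MvPolynomial.coeff_C_mul, MvPolynomial.coeff_C_mul,
    MvPolynomial.coeff_X, MvPolynomial.coeff_X]
  by_cases h : d.degree = 1
  · obtain ⟨i, rfl⟩ : ∃ i, d = Finsupp.single i 1 := by
      rw [Finsupp.degree_eq_sum, Fin.sum_univ_two] at h
      obtain ⟨h0, h1⟩ | ⟨h0, h1⟩ : d 0 = 1 ∧ d 1 = 0 ∨ d 0 = 0 ∧ d 1 = 1 := by omega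
      · exact ⟨0, Finsupp.ext fun i => by fin_cases i <;> simp [h0, h1]⟩
      · exact ⟨1, Finsupp.ext fun i => by fin_cases i <;> simp [h0, h1]⟩
    fin_cases i <;> simp [Finsupp.single_left_inj]
  · have h0 : ∀ i : Fin 2, Finsupp.single i 1 ≠ d := by
      rintro i rfl; simp at h
    simp [h, h0]

/-- A nonconstant formal first integral of the planar system makes the truncated system
integrable, through its lowest-order part. -/
theorem integrable_of_formal_firstIntegral (hP : constantCoeff P = 0) (hQ : constantCoeff Q = 0)
    (hl : homPart 1 P ≠ 0 ∨ homPart 1 Q ≠ 0) {g : MvPowerSeries (Fin 2) ℂ}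
    (hg : g ≠ C (constantCoeff g)) (h : logDeriv P Q g = 0) :
    AnalyticallyIntegrableNear (polyField (radialField (homPart 1 P) (homPart 1 Q))) 0 := by
  set g' := g - C (constantCoeff g) with hg'
  have hne : g' ≠ 0 := sub_ne_zero.2 hg
  obtain ⟨m, hm, -, hm0⟩ := exists_homPart_ne_zero (p := g') (q := g') (Or.inl hne)
  rw [or_self] at hm0
  have h' : logDeriv P Q g' = 0 := by
    rw [hg', map_sub, h, logDeriv_apply]; simp
  have hmpos : m ≠ 0 := by
    rintro rfl
    refine hm0 ?_
    ext d
    rw [coeff_homPart]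
    split_ifs with hd
    · rw [Finsupp.degree_eq_zero_iff] at hd
      rw [hd, hg']; simp
    · simp
  have hP1 : ((1 : ℕ) : ℕ∞) ≤ P.order := by
    simpa using one_le_order_iff_constCoeff_eq_zero.2 hP
  have hQ1 : ((1 : ℕ) : ℕ∞) ≤ Q.order := by
    simpa using one_le_order_iff_constCoeff_eq_zero.2 hQ
  refine integrable_of_logDerivPoly_eq_zero hl (φ := homPart m g') ?_ ?_
  · by_contra! hc
    have h1 := eq_C_of_pderiv_eq_zero hc
    rw [coeff_homPart, if_neg (by simpa using Ne.symm hmpos), MvPolynomial.C_0] at h1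
    exact hm0 h1
  · rw [← homPart_logDeriv hP1 hQ1 hm, h', homPart_zero]

/-- A formal planar field that commutes with the planar system and is generically independent of it
makes the truncated system integrable. If its lowest-order part is a constant multiple of the
truncated system, subtracting that multiple of the planar system raises the order. -/
theorem integrable_of_formal_commute (hP : constantCoeff P = 0) (hQ : constantCoeff Q = 0)
    (hl : homPart 1 P ≠ 0 ∨ homPart 1 Q ≠ 0) {p q : MvPowerSeries (Fin 2) ℂ}
    (hp : logDeriv P Q p = logDeriv p q P) (hq : logDeriv P Q q = logDeriv p q Q)
    (hpq : p * Q ≠ q * P) :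
    AnalyticallyIntegrableNear (polyField (radialField (homPart 1 P) (homPart 1 Q))) 0 := by
  have hP1 : ((1 : ℕ) : ℕ∞) ≤ P.order := by
    simpa using one_le_order_iff_constCoeff_eq_zero.2 hP
  have hQ1 : ((1 : ℕ) : ℕ∞) ≤ Q.order := by
    simpa using one_le_order_iff_constCoeff_eq_zero.2 hQ
  have step : ∀ p q : MvPowerSeries (Fin 2) ℂ, logDeriv P Q p = logDeriv p q P →
      logDeriv P Q q = logDeriv p q Q → p * Q ≠ q * P →
      AnalyticallyIntegrableNear (polyField (radialField (homPart 1 P) (homPart 1 Q))) 0 ∨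
        (homPart 1 p ≠ 0 ∨ homPart 1 q ≠ 0) ∧
        ∃ c, homPart 1 p = MvPolynomial.C c * homPart 1 P ∧
          homPart 1 q = MvPolynomial.C c * homPart 1 Q := by
    intro p q hp hq hpq
    have hne : p ≠ 0 ∨ q ≠ 0 := by
      by_contra! h
      rw [h.1, h.2, zero_mul, zero_mul] at hpq
      exact hpq rfl
    obtain ⟨m, hmp, hmq, hm0⟩ := exists_homPart_ne_zero hne
    have hp' := congrArg (homPart (1 + m)) hp
    have hq' := congrArg (homPart (1 + m)) hq
    rw [homPart_logDeriv hP1 hQ1 hmp, add_comm 1 m, homPart_logDeriv hmp hmq hP1] at hp'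
    rw [homPart_logDeriv hP1 hQ1 hmq, add_comm 1 m, homPart_logDeriv hmp hmq hQ1] at hq'
    rcases integrable_or_eq_smul homPart_one_eq homPart_one_eq hl hp' hq' with h | ⟨c, hc1, hc2⟩
    · exact Or.inl h
    · right
      -- comparing degrees, the lowest degree is one
      have hdeg : ∀ f F : MvPowerSeries (Fin 2) ℂ, homPart m f = MvPolynomial.C c * homPart 1 F →
          homPart m f ≠ 0 → m = 1 := by
        intro f F hfF hf0
        by_contra hm1
        refine hf0 ?_
        ext d
        rw [MvPolynomial.coeff_zero]
        by_cases hd : d.degree = m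
        · rw [hfF, MvPolynomial.coeff_C_mul, coeff_homPart, if_neg (by omega), mul_zero]
        · rw [coeff_homPart, if_neg hd]
      have hm1 : m = 1 := by
        rcases hm0 with h | h
        · exact hdeg p P hc1 h
        · exact hdeg q Q hc2 h
      subst hm1
      exact ⟨hm0, c, hc1, hc2⟩
  rcases step p q hp hq hpq with h | ⟨-, c, hc1, hc2⟩
  · exact h
  have hsub : ∀ g, logDeriv (p - C c * P) (q - C c * Q) g =
      logDeriv p q g - C c * logDeriv P Q g := by
    intro g
    simp only [logDeriv_apply]; ring
  have hCmul : ∀ g, logDeriv P Q (C c * g) = C c * logDeriv P Q g := by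
    intro g
    rw [← smul_eq_C_mul, Derivation.map_smul, smul_eq_C_mul]
  have hp' : logDeriv P Q (p - C c * P) = logDeriv (p - C c * P) (q - C c * Q) P := by
    rw [hsub, map_sub, hCmul, hp]
  have hq' : logDeriv P Q (q - C c * Q) = logDeriv (p - C c * P) (q - C c * Q) Q := by
    rw [hsub, map_sub, hCmul, hq]
  have hpq' : (p - C c * P) * Q ≠ (q - C c * Q) * P := fun h => hpq (by linear_combination h)
  rcases step _ _ hp' hq' hpq' with h | ⟨h, -⟩
  · exact h
  · exfalso
    rw [homPart_sub, homPart_sub, homPart_C_mul, homPart_C_mul, hc1, hc2, sub_self, sub_self] at h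
    simp at h

end Reduction

end DoubleHopf

end

noncomputable section

/-! ### Passage to complex coordinates -/

namespace DoubleHopf

section Coordinates

open MvPowerSeries

/-- The linear substitution `x₁ = (z₁ + w₁) / 2`, `x₂ = (z₁ - w₁) / (2 i)`, and likewise for
`x₃, x₄`. -/
def complexCoord : Fin 4 → MvPowerSeries (Fin 4) ℂ :=
  ![C (1 / 2) * (X 0 + X 1), C (-Complex.I / 2) * (X 0 - X 1),
    C (1 / 2) * (X 2 + X 3), C (-Complex.I / 2) * (X 2 - X 3)]

lemma constantCoeff_complexCoord (i : Fin 4) : constantCoeff (complexCoord i) = 0 := by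
  fin_cases i <;> simp [complexCoord]

lemma hasSubst_complexCoord : HasSubst complexCoord :=
  hasSubst_of_constantCoeff_zero constantCoeff_complexCoord

/-- The partial derivatives of `complexCoord`. -/
def complexCoordMatrix : Matrix (Fin 4) (Fin 4) ℂ :=
  !![1 / 2, 1 / 2, 0, 0; -Complex.I / 2, Complex.I / 2, 0, 0;
    0, 0, 1 / 2, 1 / 2; 0, 0, -Complex.I / 2, Complex.I / 2]

lemma pderiv_complexCoord (i k : Fin 4) :
    pderiv ℂ k (complexCoord i) = C (complexCoordMatrix i k) := by
  classical
  have h1 : ∀ (a : ℂ) (p q : Fin 4), pderiv ℂ k (C a * (X p + X q)) =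
      C (a * ((if k = p then 1 else 0) + (if k = q then 1 else 0))) := by
    intro a p q
    rw [Derivation.leibniz, map_add, pderiv_X, pderiv_X, pderiv_C]
    simp only [Pi.single_apply, smul_eq_mul, mul_zero, add_zero, eq_comm (a := k)]
    split_ifs <;> simp
  have h2 : ∀ (a : ℂ) (p q : Fin 4), pderiv ℂ k (C a * (X p - X q)) =
      C (a * ((if k = p then 1 else 0) - (if k = q then 1 else 0))) := by
    intro a p q
    rw [Derivation.leibniz, map_sub, pderiv_X, pderiv_X, pderiv_C]
    simp only [Pi.single_apply, smul_eq_mul, mul_zero, add_zero, eq_comm (a := k)]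
    split_ifs <;> simp
  fin_cases i <;> simp only [complexCoord, Fin.zero_eta, Fin.mk_one, Fin.reduceFinMk,
    Matrix.cons_val, h1, h2] <;> congr 1 <;> fin_cases k <;>
    simp [complexCoordMatrix] <;> ring

lemma det_complexCoordMatrix : complexCoordMatrix.det ≠ 0 := by
  have h : complexCoordMatrix.det = -(1 / 4) := by
    simp [complexCoordMatrix, Matrix.det_succ_row_zero, Fin.sum_univ_succ, Fin.succAbove]
    ring_nf
    simp
    norm_num
  rw [h]; norm_num

lemma complexCoord_sq_add_sq (i : Fin 2) :
    ![complexCoord 0 ^ 2 + complexCoord 1 ^ 2, complexCoord 2 ^ 2 + complexCoord 3 ^ 2] i =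
      radii i := by
  have h1 : (C (1 / 2) : MvPowerSeries (Fin 4) ℂ) ^ 2 = C (1 / 4) := by
    rw [← map_pow]; norm_num
  have h2 : (C (-Complex.I / 2) : MvPowerSeries (Fin 4) ℂ) ^ 2 = -C (1 / 4) := by
    rw [← map_pow, ← map_neg, div_pow, neg_sq, Complex.I_sq]; norm_num
  have h4 : (C (1 / 4) : MvPowerSeries (Fin 4) ℂ) * 4 = 1 := by
    rw [← map_ofNat C 4, ← map_mul]; norm_num
  fin_cases i
  · simp only [complexCoord, radii, Fin.zero_eta, Matrix.cons_val, mul_pow, h1, h2]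
    linear_combination (X 0 * X 1) * h4
  · simp only [complexCoord, radii, Fin.mk_one, Matrix.cons_val, mul_pow, h1, h2]
    linear_combination (X 2 * X 3) * h4

lemma map_ofReal_pderiv {σ : Type*} (F : MvPowerSeries σ ℝ) (i : σ) :
    map Complex.ofRealHom (pderiv ℝ i F) = pderiv ℂ i (map Complex.ofRealHom F) := by
  ext d
  simp [coeff_pderiv]

lemma subst_complexCoord_inSquaredRadii (h : MvPowerSeries (Fin 2) ℝ) :
    subst complexCoord (map Complex.ofRealHom (inSquaredRadii h)) =
      inRadii (MvPowerSeries.map Complex.ofRealHom h) := by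
  have hs : HasSubst (![X 0 ^ 2 + X 1 ^ 2, X 2 ^ 2 + X 3 ^ 2] :
      Fin 2 → MvPowerSeries (Fin 4) ℝ) :=
    hasSubst_of_constantCoeff_zero fun i => by fin_cases i <;> simp
  have hs' : HasSubst (fun i => map Complex.ofRealHom
      ((![X 0 ^ 2 + X 1 ^ 2, X 2 ^ 2 + X 3 ^ 2] : Fin 2 → MvPowerSeries (Fin 4) ℝ) i)) :=
    hasSubst_of_constantCoeff_zero fun i => by fin_cases i <;> simp
  rw [inSquaredRadii, map_subst hs, subst_comp_subst_apply hs' hasSubst_complexCoord, inRadii]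
  congr 1
  funext i
  have hsq : ∀ j k : Fin 4, subst complexCoord (X j ^ 2 + X k ^ 2 : MvPowerSeries (Fin 4) ℂ) =
      complexCoord j ^ 2 + complexCoord k ^ 2 := by
    intro j k
    rw [subst_add hasSubst_complexCoord, subst_pow hasSubst_complexCoord,
      subst_pow hasSubst_complexCoord, subst_X hasSubst_complexCoord, subst_X hasSubst_complexCoord]
  rw [← complexCoord_sq_add_sq]
  fin_cases i <;> simp [hsq]

/-- The normal form in the real coordinates is the diagonal field in the complex ones. -/
lemma subst_complexCoord_normalForm (ω₁ ω₂ : ℝ) (h₁ h₂ h₃ h₄ : MvPowerSeries (Fin 2) ℝ)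
    (i : Fin 4) :
    subst complexCoord (map Complex.ofRealHom (normalForm ω₁ ω₂ h₁ h₂ h₃ h₄ i)) =
      ∑ k, C (complexCoordMatrix i k) * diagField ω₁ ω₂ (map Complex.ofRealHom h₁)
        (map Complex.ofRealHom h₂) (map Complex.ofRealHom h₃) (map Complex.ofRealHom h₄) k := by
  have hI : (C Complex.I : MvPowerSeries (Fin 4) ℂ) ^ 2 = -1 := by
    rw [← map_pow, Complex.I_sq, map_neg, map_one]
  have e1 : (C (-Complex.I / 2) : MvPowerSeries (Fin 4) ℂ) = -(C Complex.I * C (1 / 2)) := by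
    rw [← map_mul, ← map_neg]; congr 1; ring
  have e2 : (C (Complex.I / 2) : MvPowerSeries (Fin 4) ℂ) = C Complex.I * C (1 / 2) := by
    rw [← map_mul]; congr 1; ring
  have hC : ∀ r : ℝ, substAlgHom (R := ℂ) hasSubst_complexCoord (C (r : ℂ)) = C (r : ℂ) := by
    intro r
    rw [substAlgHom_apply, subst_C]
  have hT : ∀ h, substAlgHom (R := ℂ) hasSubst_complexCoord
      (map Complex.ofRealHom (inSquaredRadii h)) = inRadii (MvPowerSeries.map Complex.ofRealHom h) := by
    intro h
    rw [substAlgHom_apply, subst_complexCoord_inSquaredRadii]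
  rw [← coe_substAlgHom hasSubst_complexCoord, Fin.sum_univ_four]
  fin_cases i <;>
    simp only [normalForm, diagField, diagCoeff, Fin.zero_eta, Fin.mk_one, Fin.reduceFinMk,
      Matrix.cons_val, map_add, map_sub, map_neg, map_mul, map_X, map_C,
      Complex.ofRealHom_eq_coe, hC, hT, substAlgHom_X, inRadii_add, inRadii_sub, inRadii_mul,
      inRadii_neg, inRadii_C] <;>
    simp only [complexCoordMatrix, complexCoord, Matrix.cons_val, Matrix.of_apply, e1, e2,
      map_zero, zero_mul, add_zero, zero_add]
  · ring
  · linear_combination (C (1 / 2) * (C (ω₁ : ℂ) + inRadii (MvPowerSeries.map Complex.ofRealHom h₂)) *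
      (X 0 + X 1)) * hI
  · ring
  · linear_combination (C (1 / 2) * (C (ω₂ : ℂ) + inRadii (MvPowerSeries.map Complex.ofRealHom h₄)) *
      (X 2 + X 3)) * hI

/-- A system with a given formal normal form is transformed to the diagonal field by a formal
change of complex coordinates. -/
theorem exists_formalChange {f : (Fin 4 → ℝ) → Fin 4 → ℝ} {ω₁ ω₂ : ℝ}
    {h₁ h₂ h₃ h₄ : MvPowerSeries (Fin 2) ℝ}
    (hnf : IsFormallyTransformedTo f (normalForm ω₁ ω₂ h₁ h₂ h₃ h₄)) :
    ∃ Ψ : Fin 4 → MvPowerSeries (Fin 4) ℂ, IsFormalChange Ψ ∧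
      IsPullback Ψ (fun i => map Complex.ofRealHom (taylorSeries fun x => f x i))
        (diagField ω₁ ω₂ (map Complex.ofRealHom h₁) (map Complex.ofRealHom h₂)
          (map Complex.ofRealHom h₃) (map Complex.ofRealHom h₄)) := by
  obtain ⟨Φ, hΦ0, hΦdet, hΦ⟩ := hnf
  set Φc : Fin 4 → MvPowerSeries (Fin 4) ℂ := fun i => map Complex.ofRealHom (Φ i) with hΦc
  have hΦs : HasSubst Φ := hasSubst_of_constantCoeff_zero hΦ0
  have hΦcs : HasSubst Φc := hasSubst_of_constantCoeff_zero fun i => by simp [hΦc, hΦ0]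
  have hΨ0 : ∀ i, constantCoeff (subst complexCoord (Φc i)) = 0 := fun i => by
    rw [constantCoeff_subst_eq constantCoeff_complexCoord]; simp [hΦc, hΦ0]
  have hchain : ∀ i k, pderiv ℂ k (subst complexCoord (Φc i)) =
      ∑ j, subst complexCoord (pderiv ℂ j (Φc i)) * C (complexCoordMatrix j k) := by
    intro i k
    rw [pderiv_subst constantCoeff_complexCoord]
    simp only [pderiv_complexCoord]
  refine ⟨fun i => subst complexCoord (Φc i), ⟨hΨ0, ?_⟩, ?_⟩
  · rw [isUnit_iff_constantCoeff, RingHom.map_det, isUnit_iff_ne_zero]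
    have hmat : constantCoeff.mapMatrix (jacobian fun i => subst complexCoord (Φc i)) =
        ((Matrix.of fun i j => coeff (Finsupp.single j 1) (Φ i)).map Complex.ofRealHom) *
          complexCoordMatrix := by
      ext i k
      rw [RingHom.mapMatrix_apply, Matrix.map_apply, Matrix.mul_apply, jacobian, Matrix.of_apply,
        hchain, map_sum]
      refine Finset.sum_congr rfl fun j _ => ?_
      rw [map_mul, constantCoeff_subst_eq constantCoeff_complexCoord, constantCoeff_C,
        ← coeff_zero_eq_constantCoeff_apply, coeff_pderiv]
      simp [hΦc]
    rw [hmat, Matrix.det_mul]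
    refine mul_ne_zero ?_ det_complexCoordMatrix
    rw [← RingHom.mapMatrix_apply, ← RingHom.map_det]
    exact (map_ne_zero _).2 hΦdet.ne_zero
  · funext i
    have h1 := congrArg (MvPowerSeries.map Complex.ofRealHom) (hΦ i)
    rw [map_subst hΦs, map_sum] at h1
    rw [← subst_comp_subst_apply hΦcs hasSubst_complexCoord, ← h1,
      ← coe_substAlgHom hasSubst_complexCoord, map_sum]
    simp only [Matrix.mulVec, dotProduct, jacobian, Matrix.of_apply, map_mul]
    simp only [coe_substAlgHom hasSubst_complexCoord, subst_complexCoord_normalForm,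
      map_ofReal_pderiv, Finset.mul_sum, hchain, Finset.sum_mul]
    rw [Finset.sum_comm]
    exact Finset.sum_congr rfl fun j _ => Finset.sum_congr rfl fun k _ => by ring

end Coordinates

end DoubleHopf

end

noncomputable section

/-! ### From analytic to formal integrability -/

namespace DoubleHopf

section Germs

variable {n : ℕ}

/-- The Taylor series of the components of a vector field. -/
def taylorField (V : (Fin n → ℂ) → Fin n → ℂ) : Fin n → MvPowerSeries (Fin n) ℂ :=
  fun k => taylor fun x => V x k

lemma taylor_fderiv_apply {V : (Fin n → ℂ) → Fin n → ℂ} {G : (Fin n → ℂ) → ℂ}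
    (hV : AnalyticAt ℂ V 0) (hG : AnalyticAt ℂ G 0) :
    taylor (fun x => fderiv ℂ G x (V x)) =
      MvPowerSeries.lieDeriv (taylorField V) (taylor G) := by
  have hVk : ∀ k, AnalyticAt ℂ (fun x => V x k) 0 := analyticAt_pi_iff.1 hV
  have h1 : (fun x => fderiv ℂ G x (V x)) = ∑ k, (fun x => V x k) * partialD ℂ k G := by
    funext x
    rw [fderiv_apply_eq_sum, Finset.sum_apply]
    rfl
  rw [h1, taylor_sum _ fun k _ => (hVk k).mul (partialD_analyticAt hG),
    MvPowerSeries.lieDeriv_apply]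
  refine Finset.sum_congr rfl fun k _ => ?_
  rw [taylor_mul (hVk k) (partialD_analyticAt hG), pderiv_taylor hG]
  rfl

lemma lieDeriv_taylorField_comm {V W : (Fin n → ℂ) → Fin n → ℂ} (hV : AnalyticAt ℂ V 0)
    (hW : AnalyticAt ℂ W 0) (h : ∀ᶠ x in 𝓝 0, VectorField.lieBracket ℂ V W x = 0) (k : Fin n) :
    MvPowerSeries.lieDeriv (taylorField V) (taylorField W k) =
      MvPowerSeries.lieDeriv (taylorField W) (taylorField V k) := by
  have hVk : ∀ k, AnalyticAt ℂ (fun x => V x k) 0 := analyticAt_pi_iff.1 hV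
  have hWk : ∀ k, AnalyticAt ℂ (fun x => W x k) 0 := analyticAt_pi_iff.1 hW
  have h1 := taylor_fderiv_apply hV (hWk k)
  have h2 := taylor_fderiv_apply hW (hVk k)
  rw [taylorField, taylorField] at *
  rw [← h1, ← h2]
  refine taylor_congr ?_
  filter_upwards [h, hV.eventually_analyticAt, hW.eventually_analyticAt] with x hx hVx hWx
  have key : ∀ {U : (Fin n → ℂ) → Fin n → ℂ} (v : Fin n → ℂ), AnalyticAt ℂ U x →
      fderiv ℂ (fun x => U x k) x v = fderiv ℂ U x v k := by
    intro U v hU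
    have := (hasFDerivAt_pi'.1 hU.differentiableAt.hasFDerivAt k).fderiv
    rw [this]; rfl
  have := congrFun hx k
  simp only [VectorField.lieBracket, Pi.sub_apply, Pi.zero_apply] at this
  rw [key _ hWx, key _ hVx]
  exact sub_eq_zero.1 this

lemma taylor_det {m : ℕ} {M : Fin m → Fin m → (Fin n → ℂ) → ℂ}
    (hM : ∀ i j, AnalyticAt ℂ (M i j) 0) :
    taylor (fun x => (Matrix.of fun i j => M i j x).det) =
      (Matrix.of fun i j => taylor (M i j)).det := by
  have h1 : (fun x => (Matrix.of fun i j => M i j x).det) =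
      ∑ σ : Equiv.Perm (Fin m), (fun _ => ((Equiv.Perm.sign σ : ℤ) : ℂ)) * ∏ i, M (σ i) i := by
    funext x
    rw [Matrix.det_apply', Finset.sum_apply]
    simp
  have hprod : ∀ σ : Equiv.Perm (Fin m), AnalyticAt ℂ (∏ i, M (σ i) i) 0 := fun σ =>
    Finset.analyticAt_prod _ fun i _ => hM (σ i) i
  rw [h1, taylor_sum _ fun σ _ => analyticAt_const.mul (hprod σ), Matrix.det_apply']
  refine Finset.sum_congr rfl fun σ _ => ?_
  rw [taylor_mul analyticAt_const (hprod σ), taylor_const, taylor_prod _ fun i _ => hM (σ i) i]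
  simp

/-- A property that holds almost everywhere on a neighbourhood of a point cannot fail everywhere
near that point. -/
lemma false_of_ae_of_eventually {U : Set (Fin n → ℂ)} (hU : IsOpen U) {x₀ : Fin n → ℂ}
    (hx₀ : x₀ ∈ U) {p : (Fin n → ℂ) → Prop} (h : ∀ᵐ x ∂(volume.restrict U), p x)
    (h' : ∀ᶠ x in 𝓝 x₀, ¬ p x) : False := by
  rw [ae_restrict_iff' hU.measurableSet] at h
  have h0 : ∀ᵐ x : Fin n → ℂ, x ∈ U → p x := h
  obtain ⟨S, hS, hSo, hxS⟩ := eventually_nhds_iff.1 (h'.and (hU.mem_nhds hx₀))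
  have hpos : volume S ≠ 0 := (hSo.measure_pos volume ⟨x₀, hxS⟩).ne'
  refine hpos (measure_mono_null (fun x hx => ?_) (ae_iff.1 h0))
  simp only [Set.mem_ofPred_eq, Classical.not_imp]
  exact ⟨(hS x hx).2, (hS x hx).1⟩

end Germs

section Formal

open MvPowerSeries

variable {ω₁ ω₂ : ℝ} {h₁ h₂ h₃ h₄ : MvPowerSeries (Fin 2) ℂ}

/-- Among four formal vector fields with nonvanishing determinant that commute with the normal
form, one induces a planar field independent of the planar system. -/
theorem exists_independent_planar (hne : h₁ ≠ 0 ∨ h₃ ≠ 0)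
    {W : Fin 4 → Fin 4 → MvPowerSeries (Fin 4) ℂ} {p q : Fin 4 → MvPowerSeries (Fin 2) ℂ}
    (hdet : (Matrix.of fun k j => W j k).det ≠ 0)
    (hp : ∀ j, lieDeriv (W j) (radii 0) = inRadii (X 0 * p j))
    (hq : ∀ j, lieDeriv (W j) (radii 1) = inRadii (X 1 * q j)) :
    ∃ j, p j * h₃ ≠ q j * h₁ := by
  by_contra! hc
  have hX : ∀ i : Fin 4, (X i : MvPowerSeries (Fin 4) ℂ) ≠ 0 := mvX_ne_zero
  have hrad : ∀ i, radii i ≠ 0 := by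
    intro i
    fin_cases i
    exacts [mul_ne_zero (hX 0) (hX 1), mul_ne_zero (hX 2) (hX 3)]
  have hinj : ∀ g, inRadii g = 0 → g = 0 := fun g hg => inRadii_injective
    (hg.trans inRadii_zero.symm)
  -- a covector annihilated by all fields
  set c : Fin 4 → MvPowerSeries (Fin 4) ℂ := fun k =>
    inRadii h₃ * radii 1 * pderiv ℂ k (radii 0) - inRadii h₁ * radii 0 * pderiv ℂ k (radii 1)
    with hcdef
  have hcW : Matrix.vecMul c (Matrix.of fun k j => W j k) = 0 := by
    funext j
    have h1 : Matrix.vecMul c (Matrix.of fun k j => W j k) j =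
        inRadii h₃ * radii 1 * lieDeriv (W j) (radii 0) -
          inRadii h₁ * radii 0 * lieDeriv (W j) (radii 1) := by
      change ∑ k, c k * W j k = _
      simp only [lieDeriv_apply, Finset.mul_sum, ← Finset.sum_sub_distrib]
      refine Finset.sum_congr rfl fun k _ => ?_
      simp only [hcdef]
      ring
    have h2 : inRadii (p j) * inRadii h₃ = inRadii (q j) * inRadii h₁ := by
      rw [← inRadii_mul, ← inRadii_mul, hc]
    rw [h1, hp, hq, inRadii_mul, inRadii_mul, inRadii_X, inRadii_X, Pi.zero_apply]
    linear_combination radii 0 * radii 1 * h2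
  have hc0 := Matrix.eq_zero_of_vecMul_eq_zero hdet hcW
  have e1 := congrFun hc0 1
  have e3 := congrFun hc0 3
  have d1 : pderiv ℂ 1 (radii 0) = X 0 := by
    rw [radii_zero, Derivation.leibniz]; simp [pderiv_X_of_ne]
  have d2 : pderiv ℂ 1 (radii 1) = 0 := by
    rw [radii_one, Derivation.leibniz]; simp [pderiv_X_of_ne]
  have d3 : pderiv ℂ 3 (radii 0) = 0 := by
    rw [radii_zero, Derivation.leibniz]; simp [pderiv_X_of_ne]
  have d4 : pderiv ℂ 3 (radii 1) = X 2 := by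
    rw [radii_one, Derivation.leibniz]; simp [pderiv_X_of_ne]
  simp only [hcdef, d1, d2, mul_zero, sub_zero, Pi.zero_apply, mul_eq_zero, hrad, hX,
    or_false] at e1
  simp only [hcdef, d3, d4, mul_zero, zero_sub, Pi.zero_apply, neg_eq_zero, mul_eq_zero, hrad, hX,
    or_false] at e3
  rcases hne with h | h
  · exact h (hinj _ e3)
  · exact h (hinj _ e1)

end Formal

end DoubleHopf

end

open DoubleHopf

theorem mainTheorem8
    (f : (Fin 4 → ℝ) → (Fin 4 → ℝ)) (ω₁ ω₂ : ℝ) (hf : DoubleHopf.IsDoubleHopf f ω₁ ω₂)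
    (h₁ h₂ h₃ h₄ : MvPowerSeries (Fin 2) ℝ)
    (h₁_zero : MvPowerSeries.constantCoeff h₁ = 0) (h₂_zero : MvPowerSeries.constantCoeff h₂ = 0)
    (h₃_zero : MvPowerSeries.constantCoeff h₃ = 0) (h₄_zero : MvPowerSeries.constantCoeff h₄ = 0)
    (hnf : DoubleHopf.IsFormallyTransformedTo f (DoubleHopf.normalForm ω₁ ω₂ h₁ h₂ h₃ h₄))
    (α₁ α₂ α₃ α₄ : ℝ)
    (hα₁ : α₁ = MvPowerSeries.coeff (Finsupp.single 0 1) h₁)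
    (hα₂ : α₂ = MvPowerSeries.coeff (Finsupp.single 1 1) h₁)
    (hα₃ : α₃ = MvPowerSeries.coeff (Finsupp.single 0 1) h₃)
    (hα₄ : α₄ = MvPowerSeries.coeff (Finsupp.single 1 1) h₃)
    (hα : ¬ (α₁ = 0 ∧ α₂ = 0 ∧ α₃ = 0 ∧ α₄ = 0))
    (fc : (Fin 4 → ℂ) → (Fin 4 → ℂ)) (hfc : DoubleHopf.IsComplexification f fc)
    (hint : DoubleHopf.AnalyticallyIntegrableNear fc 0) :
    DoubleHopf.AnalyticallyIntegrableNear (DoubleHopf.truncatedPlanar α₁ α₂ α₃ α₄) 0 := by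
  obtain ⟨Ψ, hΨ, hX⟩ := exists_formalChange hnf
  set P := MvPowerSeries.map Complex.ofRealHom h₁ with hP
  set Q := MvPowerSeries.map Complex.ofRealHom h₃ with hQ
  set H₂ := MvPowerSeries.map Complex.ofRealHom h₂
  set H₄ := MvPowerSeries.map Complex.ofRealHom h₄
  have hP0 : MvPowerSeries.constantCoeff P = 0 := by simp [hP, h₁_zero]
  have hQ0 : MvPowerSeries.constantCoeff Q = 0 := by simp [hQ, h₃_zero]
  have hres := isBalanced_of_sum_eq_zero (ω₁ := ω₁) hf.pos₂.ne' hf.irrational hP0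
    (h₂ := H₂) (by simp [H₂, h₂_zero]) hQ0 (h₄ := H₄) (by simp [H₄, h₄_zero])
  have hPα : homPart 1 P = MvPolynomial.C (α₁ : ℂ) * MvPolynomial.X 0 +
      MvPolynomial.C (α₂ : ℂ) * MvPolynomial.X 1 := by
    rw [homPart_one_eq, hP, hα₁, hα₂]; simp
  have hQα : homPart 1 Q = MvPolynomial.C (α₃ : ℂ) * MvPolynomial.X 0 +
      MvPolynomial.C (α₄ : ℂ) * MvPolynomial.X 1 := by
    rw [homPart_one_eq, hQ, hα₃, hα₄]; simp
  have hlin : homPart 1 P ≠ 0 ∨ homPart 1 Q ≠ 0 := by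
    have key : ∀ {F : MvPowerSeries (Fin 2) ℂ} (i : Fin 2), homPart 1 F = 0 →
        MvPowerSeries.coeff (Finsupp.single i 1) F = 0 := by
      intro F i h
      have := congrArg (MvPolynomial.coeff (Finsupp.single i 1)) h
      simpa [coeff_homPart] using this
    by_contra! hc
    refine hα ⟨?_, ?_, ?_, ?_⟩
    · have := key 0 hc.1; simpa [hP, hα₁] using this
    · have := key 1 hc.1; simpa [hP, hα₂] using this
    · have := key 0 hc.2; simpa [hQ, hα₃] using this
    · have := key 1 hc.2; simpa [hQ, hα₄] using this
  rw [truncatedPlanar_eq, ← hPα, ← hQα]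
  obtain ⟨m, k, hm, hmk, U, V, F, hU, h0U, hV0, hV, hF, hVind, hbr, hFind, hFV⟩ := hint
  have hVa : ∀ j, AnalyticAt ℂ (V j) 0 := fun j => hV j 0 h0U
  -- the Taylor series of the given system
  have hV0T : taylorField (V ⟨0, hm⟩) =
      fun i => MvPowerSeries.map Complex.ofRealHom (taylorSeries fun x => f x i) := by
    funext i
    have h1 : (fun x => V ⟨0, hm⟩ x i) =ᶠ[𝓝 0] fun x => fc x i := by
      filter_upwards [hU.mem_nhds h0U] with x hx
      rw [hV0 hx]
    rw [taylorField, taylor_congr h1]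
    exact taylor_complexification (analyticAt_pi_iff.1 hfc.1 i) (analyticAt_pi_iff.1 hf.analytic i)
      (hfc.2.mono fun x hx => congrFun hx i)
  rw [← hV0T] at hX
  rcases Nat.eq_zero_or_pos k with hk | hk
  · -- four commuting vector fields
    subst hk
    obtain rfl : m = 4 := hmk
    have hcomm : ∀ j i, MvPowerSeries.lieDeriv (taylorField (V ⟨0, hm⟩)) (taylorField (V j) i) =
        MvPowerSeries.lieDeriv (taylorField (V j)) (taylorField (V ⟨0, hm⟩) i) := fun j i =>
      lieDeriv_taylorField_comm (hVa _) (hVa j)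
        (Filter.eventually_of_mem (hU.mem_nhds h0U) fun x hx => hbr _ j x hx) i
    choose W hW using fun j => hΨ.exists_isPullback (taylorField (V j))
    choose p q hp hq hpP hqQ using fun j => exists_inRadii_of_commute hres hP0 hQ0
      (hΨ.lieDeriv_comm hX (hW j) (hcomm j))
    have hdetV : (Matrix.of fun i j => taylorField (V j) i).det ≠ 0 := by
      intro h
      have h1 := taylor_det (M := fun i j x => V j x i)
        (fun i j => analyticAt_pi_iff.1 (hVa j) i)
      have h2 := eventually_eq_zero_of_taylor_eq_zero (F := fun x =>
        (Matrix.of fun i j => V j x i).det) ?_ (h1.trans h)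
      · refine false_of_ae_of_eventually hU h0U hVind (h2.mono fun x hx hli => ?_)
        have h3 : LinearIndependent ℂ (Matrix.of fun i j => V j x i).col := hli
        rw [Matrix.linearIndependent_cols_iff_isUnit, Matrix.isUnit_iff_isUnit_det] at h3
        exact h3.ne_zero hx
      · simp only [Matrix.det_apply', Matrix.of_apply]
        exact Finset.analyticAt_fun_sum _ fun σ _ => analyticAt_const.mul
          (Finset.analyticAt_fun_prod _ fun i _ => analyticAt_pi_iff.1 (hVa i) _)
    have hdetW : (Matrix.of fun k j => W j k).det ≠ 0 := by
      intro h
      have h1 : MvPowerSeries.jacobian Ψ * Matrix.of (fun k j => W j k) =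
          (MvPowerSeries.substAlgHom (R := ℂ) hΨ.hasSubst).toRingHom.mapMatrix
            (Matrix.of fun i j => taylorField (V j) i) := by
        refine Matrix.ext fun i j => ?_
        have := congrFun (hW j) i
        rw [RingHom.mapMatrix_apply, Matrix.map_apply, Matrix.of_apply]
        refine Eq.trans this ?_
        exact (MvPowerSeries.substAlgHom_apply hΨ.hasSubst _).symm
      have h2 := congrArg Matrix.det h1
      rw [Matrix.det_mul, h, mul_zero, ← RingHom.map_det] at h2
      refine hdetV (hΨ.eq_zero_of_subst_eq_zero ?_)
      rw [← MvPowerSeries.substAlgHom_apply hΨ.hasSubst]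
      exact h2.symm
    have hne : P ≠ 0 ∨ Q ≠ 0 := hlin.imp (fun h h' => h (by rw [h', homPart_zero]))
      fun h h' => h (by rw [h', homPart_zero])
    obtain ⟨j, hj⟩ := exists_independent_planar hne hdetW hp hq
    exact integrable_of_formal_commute hP0 hQ0 hlin (hpP j) (hqQ j) hj
  · -- an analytic first integral
    set F₀ := F ⟨0, hk⟩ with hF₀
    have hFa : AnalyticAt ℂ F₀ 0 := hF _ 0 h0U
    have hLF : MvPowerSeries.lieDeriv (taylorField (V ⟨0, hm⟩)) (taylor F₀) = 0 := by
      rw [← taylor_fderiv_apply (hVa _) hFa]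
      have h1 : (fun x => fderiv ℂ F₀ x (V ⟨0, hm⟩ x)) =ᶠ[𝓝 0] fun _ => 0 := by
        filter_upwards [hU.mem_nhds h0U] with x hx
        exact hFV _ _ x hx
      rw [taylor_congr h1, taylor_const, map_zero]
    have hG : MvPowerSeries.lieDeriv (diagField ω₁ ω₂ P H₂ Q H₄)
        (MvPowerSeries.subst Ψ (taylor F₀)) = 0 := by
      rw [hX.lieDeriv_subst hΨ, hLF, ← MvPowerSeries.substAlgHom_apply hΨ.hasSubst, map_zero]
    obtain ⟨g, hg, hLg⟩ := exists_inRadii_of_firstIntegral hres hG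
    refine integrable_of_formal_firstIntegral hP0 hQ0 hlin (g := g) (fun hgc => ?_) hLg
    -- a constant first integral has vanishing differential
    set c := MvPowerSeries.constantCoeff g
    have hFc : taylor F₀ - MvPowerSeries.C c = 0 := by
      refine hΨ.eq_zero_of_subst_eq_zero ?_
      rw [MvPowerSeries.subst_sub hΨ.hasSubst, MvPowerSeries.subst_C, hg, hgc, inRadii_C, sub_self]
    have hpd : ∀ i, ∀ᶠ x in 𝓝 0, partialD ℂ i F₀ x = 0 := fun i => by
      refine eventually_eq_zero_of_taylor_eq_zero (partialD_analyticAt hFa) ?_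
      rw [← pderiv_taylor hFa, sub_eq_zero.1 hFc, MvPowerSeries.pderiv_C]
    refine false_of_ae_of_eventually hU h0U hFind
      ((Filter.eventually_all.2 hpd).mono fun x hx hli => ?_)
    refine hli.ne_zero ⟨0, hk⟩ (ContinuousLinearMap.ext fun v => ?_)
    rw [← hF₀, fderiv_apply_eq_sum]
    simp [hx]
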